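/- Let $0\le k\le r$ be integers, $B_r=\mathbb Q[e_1,\dots,e_r]$, $E_r(z)=1-e_1z+\cdots+(-1)^re_rz^r$, and let $H_r=(h_n)_{n\in\mathbb Z}$ be given by $\sum_{n\in\mathbb Z}h_nz^n=1/E_r(z)$ (so $h_n=0$ for $n<0$). For a partition $\lambda=(\lambda_1\ge\dots\ge\lambda_r\ge0)$ put $\Delta_\lambda(H_r)=\det(h_{\lambda_j-j+i})_{1\le i,j\le r}$. Let $V=\bigoplus_{i\ge0}\mathbb Q\,b_i$, let $\beta_j$ be the linear forms with $\beta_j(b_i)=\delta_{ij}$, and put $[\mathbf b]^r_\lambda=b_{r-1+\lambda_1}\wedge b_{r-2+\lambda_2}\wedge\cdots\wedge b_{\lambda_r}$ and $[\beta]^k_\nu=\beta_{k-1+\nu_1}\wedge\cdots\wedge\beta_{\nu_k}$. The map $\Delta_\lambda(H_r)\mapsto[\mathbf b]^r_\lambda$ defines a linear isomorphism $B_r\to\bigwedge^rV$, written $f\mapsto f\,[\mathbf b]^r_0$. For partitions $\mu,\nu$ with at most $k$ parts let $\mathcal E^k_{\mu,\nu}:B_r\to B_r$ be defined by $(\mathcal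 E^k_{\mu,\nu}f)[\mathbf b]^r_0=[\mathbf b]^k_\mu\wedge\big([\beta]^k_\nu\lrcorner (f[\mathbf b]^r_0)\big)$, where $\eta(\alpha\lrcorner u)=(\alpha\wedge\eta)(u)$. With $\mathbf z_k=(z_1,\dots,z_k)$, $\mathbf w_k^{-1}=(w_1^{-1},\dots,w_k^{-1})$ and Schur polynomials $s_\mu,s_\nu$, put $$\mathcal E(\mathbf z_k,\mathbf w_k^{-1})=\sum_{\mu,\nu}s_\mu(\mathbf z_k)\,s_\nu(\mathbf w_k^{-1})\,\mathcal E^k_{\mu,\nu}:\ B_r\to B_r[[\mathbf z_k,\mathbf w_k^{-1}]]$$ (in each degree the sum is finite). Let $\overline\sigma_-(z)$ be the multiplicative map on $\bigwedge V$ with $\overline\sigma_-(z)b_j=b_j-b_{j-1}z^{-1}$ (where $b_{-1}=0$), transported from $\bigwedge^r V$ to $B_r$ by the isomorphism above, and $\overline\sigma_-(\mathbf z_k)=\overline\sigma_-(z_1)\cdots\overline\sigma_-(z_k)$. Finally let $\Delta_\lambda(\mathbf w_k^{-1},\overline\sigma_-(\mathbf z_k)H_r)$ be the determinant of the $r\times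 r$ matrix whose entry in row $i$ and column $j$ is $w_i^{-(\lambda_j-j+i)}$ for $i\le k$ and $\overline\sigma_-(\mathbf z_k)h_{\lambda_j-j+i}$ for $i>k$. Then there are unique elements $x_j\in B_r$, $j\ge1$, with $\exp\big(\sum_{j\ge1}x_jz^j\big)=1/E_r(z)$. They satisfy $j\,x_j=y_1^j+\cdots+y_r^j$ in every commutative $B_r$-algebra in which $E_r(z)=\prod_{i=1}^r(1-y_iz)$; with $p_j(\mathbf z_k)=z_1^j+\cdots+z_k^j$ one has $\prod_{j=1}^k1/E_r(z_j)=\exp\big(\sum_{j\ge1}x_jp_j(\mathbf z_k)\big)$. For every partition $\lambda$ with at most $r$ parts, in $B_r[[\mathbf z_k,\mathbf w_k^{-1}]][\mathbf z_k^{-1},\mathbf w_k]$, $$\prod_{1\le i<j\le k}\Big(1-\frac{w_i}{w_j}\Big)\cdot\mathcal E(\mathbf z_k,\mathbf w_k^{-1})\Delta_\lambda(H_r)=\prod_{j=1}^k\Big(\frac{z_j}{w_j}\Big)^{r-k}\exp\Big(\sum_{j\ge1}x_jp_j(\mathbf z_k)\Big)\,\Delta_\lambda(\mathbf w_k^{-1},\overline\sigma_-(\mathbf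 z_k)H_r),$$ and the factor $\prod_{i<j}(1-w_i/w_j)$ is not a zero divisor there, so the formula determines $\mathcal E(\mathbf z_k,\mathbf w_k^{-1})\Delta_\lambda(H_r)$. -/

import Mathlib

noncomputable section

namespace SchubertVertex

open Finset

/-! ### The ring `B_r`, the sequence `H_r` and the Schur determinants -/

/-- `B_r = ℚ[e_1, …, e_r]`; the variable `MvPolynomial.X i` is `e_{i+1}`. -/
abbrev B (r : ℕ) : Type := MvPolynomial (Fin r) ℚ

/-- The generic polynomial `E_r(z) = 1 - e_1 z + ⋯ + (-1)^r e_r z^r`. -/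
def E (r : ℕ) : PowerSeries (B r) :=
  1 + ∑ i : Fin r,
    (-1) ^ (i.val + 1) * PowerSeries.C (MvPolynomial.X i) * PowerSeries.X ^ (i.val + 1)

/-- The inverse power series `1 / E_r(z)`. -/
def invE (r : ℕ) : PowerSeries (B r) := PowerSeries.invOfUnit (E r) 1

/-- The sequence `H_r = (h_n)_{n ∈ ℤ}`, where `∑ h_n z^n = 1 / E_r(z)`; so `h_n = 0` for `n < 0`. -/
def h (r : ℕ) (n : ℤ) : B r := if 0 ≤ n then PowerSeries.coeff n.toNat (invE r) else 0

/-- Partitions of length at most `k`, as non-increasing sequences of `k` natural numbers. -/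
abbrev Part (k : ℕ) : Type := {lam : Fin k → ℕ // Antitone lam}

/-- The Schur determinant `Δ_λ(H_r) = det (h_{λ_j - j + i})`. -/
def schurDet {r : ℕ} (lam : Part r) : B r :=
  (Matrix.of fun i j : Fin r => h r ((lam.1 j : ℤ) - j + i)).det

/-! ### The exterior algebra of `V` -/

/-- `V = ⨁_{i ≥ 0} ℚ b_i`. -/
abbrev V : Type := ℕ →₀ ℚ

/-- The basis vector `b_n` of `V`. -/
def b (n : ℕ) : V := Finsupp.single n 1

/-- The linear form `β_n` on `V`, with `β_n (b_m) = δ_{nm}`. -/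
def beta (n : ℕ) : Module.Dual ℚ V := Finsupp.lapply n

/-- The exterior algebra of `V`. -/
abbrev Wedge : Type := ExteriorAlgebra ℚ V

/-- `[b]^r_λ = b_{r-1+λ_1} ∧ b_{r-2+λ_2} ∧ ⋯ ∧ b_{λ_r}`. -/
def wedgeB {r : ℕ} (lam : Part r) : Wedge :=
  ExteriorAlgebra.ιMulti ℚ r fun j : Fin r => b (r - 1 - j + lam.1 j)

/-- The alternating map with
`(b_{a_1}, …, b_{a_r}) ↦ det (h_{a_j - (r - 1) + i})`, for `0 ≤ i ≤ r - 1`. -/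
def altB (r : ℕ) : V [⋀^Fin r]→ₗ[ℚ] B r :=
  let T : V →ₗ[ℚ] (Fin r → B r) :=
    Finsupp.linearCombination ℚ fun (n : ℕ) (i : Fin r) => h r ((n : ℤ) - (r - 1) + i)
  { toFun := fun v => (Matrix.of fun i j : Fin r => T (v j) i).det
    map_update_add' := by
      intro inst v j x y
      obtain rfl : inst = instDecidableEqFin r := Subsingleton.elim _ _
      have key : ∀ u, (Matrix.of fun i l : Fin r => T (Function.update v j u l) i) =
          (Matrix.of fun i l : Fin r => T (v l) i).updateCol j (T u) := by
        intro u
        ext i l : 2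
        rcases eq_or_ne l j with rfl | hl <;> simp [*]
      rw [key, key, key, map_add, Matrix.det_updateCol_add]
    map_update_smul' := by
      intro inst v j c x
      obtain rfl : inst = instDecidableEqFin r := Subsingleton.elim _ _
      have key : ∀ u, (Matrix.of fun i l : Fin r => T (Function.update v j u l) i) =
          (Matrix.of fun i l : Fin r => T (v l) i).updateCol j (T u) := by
        intro u
        ext i l : 2
        rcases eq_or_ne l j with rfl | hl <;> simp [*]
      have hc : T (c • x) = (algebraMap ℚ (B r) c) • T x := by
        rw [map_smul, algebraMap_smul]
      rw [key, key, hc, Matrix.det_updateCol_smul, Algebra.smul_def]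
    map_eq_zero_of_eq' := by
      intro v i j hv hij
      exact Matrix.det_zero_of_column_eq hij fun l => by simp [hv] }

/-- The linear map from the exterior algebra to `B_r` that is `altB` in degree `r` and zero in
all other degrees. It sends `[b]^r_λ` to `Δ_λ(H_r)`. -/
def toB (r : ℕ) : Wedge →ₗ[ℚ] B r := ExteriorAlgebra.liftAlternating (Pi.single r (altB r))

theorem altB_b (r : ℕ) (a : Fin r → ℕ) :
    altB r (fun j => b (a j)) =
      (Matrix.of fun i j : Fin r => h r ((a j : ℤ) - (r - 1) + i)).det := by
  simp [altB, b]

theorem toB_ιMulti (r : ℕ) (v : Fin r → V) :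
    toB r (ExteriorAlgebra.ιMulti ℚ r v) = altB r v := by
  simp [toB, ExteriorAlgebra.liftAlternating_apply_ιMulti]

theorem toB_wedgeB {r : ℕ} (lam : Part r) : toB r (wedgeB lam) = schurDet lam := by
  rw [wedgeB, toB_ιMulti, altB_b, schurDet]
  congr 1
  ext1 i j
  simp only [Matrix.of_apply]
  congr 1
  have := j.2
  omega

theorem E_mul_invE (r : ℕ) : E r * invE r = 1 := by
  apply PowerSeries.mul_invOfUnit
  simp [E]

/-- The embedding of `B_r` into `ℚ[y_1, …, y_r]` onto the symmetric polynomials. -/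
def ev (r : ℕ) : B r →ₐ[ℚ] MvPolynomial (Fin r) ℚ :=
  MvPolynomial.aeval fun i : Fin r => MvPolynomial.esymm (Fin r) ℚ (i + 1)

theorem ev_injective (r : ℕ) : Function.Injective (ev r) := by
  intro p q hpq
  apply MvPolynomial.esymmAlgHom_injective (σ := Fin r) (R := ℚ) (n := r) (by simp)
  apply Subtype.ext
  rw [MvPolynomial.esymmAlgHom_apply, MvPolynomial.esymmAlgHom_apply]
  exact hpq

theorem map_ev_E (r : ℕ) :
    PowerSeries.map (ev r).toRingHom (E r) =
      ∏ i : Fin r, (1 - PowerSeries.C (MvPolynomial.X i) * PowerSeries.X) := by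
  have h1 : ∏ i : Fin r, (1 - PowerSeries.C (MvPolynomial.X (R := ℚ) i) * PowerSeries.X) =
      ∑ j ∈ range (r + 1), (-1) ^ j * PowerSeries.C (MvPolynomial.esymm (Fin r) ℚ j) *
        PowerSeries.X ^ j := by
    simp_rw [sub_eq_add_neg]
    rw [Finset.prod_one_add, Finset.sum_powerset, Finset.card_univ, Fintype.card_fin]
    refine Finset.sum_congr rfl fun j _ => ?_
    rw [MvPolynomial.esymm, map_sum, Finset.mul_sum, Finset.sum_mul]
    refine Finset.sum_congr rfl fun t ht => ?_
    rw [Finset.mem_powersetCard] at ht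
    rw [Finset.prod_neg, ht.2, Finset.prod_mul_distrib, Finset.prod_const, ht.2, map_prod, mul_assoc]
  rw [h1, Finset.sum_range_succ', E, map_add, map_one, map_sum, ← Fin.sum_univ_eq_sum_range
    (fun j => (-1) ^ (j + 1) * PowerSeries.C (MvPolynomial.esymm (Fin r) ℚ (j + 1)) *
      PowerSeries.X ^ (j + 1))]
  rw [add_comm]
  congr 1
  · refine Finset.sum_congr rfl fun i _ => ?_
    simp [ev]
  · simp

/-- `∏_{s ≠ i} (1 - y_s z)`. -/
def cofE (r : ℕ) (i : Fin r) : PowerSeries (MvPolynomial (Fin r) ℚ) :=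
  ∏ s ∈ univ.erase i, (1 - PowerSeries.C (MvPolynomial.X s) * PowerSeries.X)

theorem coeff_prod_eq_zero {R ι : Type*} [CommRing R] [DecidableEq ι] (y : ι → R) (S : Finset ι) :
    ∀ m, S.card < m →
      PowerSeries.coeff m (∏ s ∈ S, (1 - PowerSeries.C (y s) * PowerSeries.X)) = 0 := by
  induction S using Finset.induction_on with
  | empty =>
    intro m hm
    simp at hm
    simp [PowerSeries.coeff_one, hm.ne']
  | insert a S ha ih =>
    intro m hm
    rw [Finset.card_insert_of_notMem ha] at hm
    rw [Finset.prod_insert ha, sub_mul, one_mul, map_sub, ih m (by omega), mul_assoc,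
      PowerSeries.coeff_C_mul]
    obtain ⟨m, rfl⟩ : ∃ n, m = n + 1 := ⟨m - 1, by omega⟩
    rw [PowerSeries.coeff_succ_X_mul, ih m (by omega)]
    simp

theorem pow_eq_sum (r : ℕ) (i : Fin r) (a : ℕ) :
    (MvPolynomial.X i : MvPolynomial (Fin r) ℚ) ^ a =
      ∑ m : Fin r, PowerSeries.coeff (r - 1 - m.val) (cofE r i) *
        ev r (h r ((a : ℤ) - (r - 1) + m)) := by
  have h1 : (1 - PowerSeries.C (MvPolynomial.X i) * PowerSeries.X) *
      PowerSeries.mk (fun n => (MvPolynomial.X i : MvPolynomial (Fin r) ℚ) ^ n) = 1 := by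
    ext n
    rw [sub_mul, one_mul, map_sub, mul_assoc, PowerSeries.coeff_C_mul]
    cases n with
    | zero => simp
    | succ n => rw [PowerSeries.coeff_succ_X_mul]; simp [PowerSeries.coeff_one, pow_succ']
  have h2 : PowerSeries.map (ev r).toRingHom (E r) *
      PowerSeries.map (ev r).toRingHom (invE r) = 1 := by
    rw [← map_mul, E_mul_invE, map_one]
  have h3 : PowerSeries.mk (fun n => (MvPolynomial.X i : MvPolynomial (Fin r) ℚ) ^ n) =
      cofE r i * PowerSeries.map (ev r).toRingHom (invE r) := by
    rw [map_ev_E, ← Finset.mul_prod_erase univ _ (mem_univ i)] at h2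
    change (1 - _) * cofE r i * _ = 1 at h2
    linear_combination (PowerSeries.mk fun n => (MvPolynomial.X i : MvPolynomial (Fin r) ℚ) ^ n) *
      (-h2) + cofE r i * PowerSeries.map (ev r).toRingHom (invE r) * h1
  have h4 := congrArg (PowerSeries.coeff a) h3
  rw [PowerSeries.coeff_mk, PowerSeries.coeff_mul, Finset.Nat.sum_antidiagonal_eq_sum_range_succ_mk]
    at h4
  rw [h4]
  have h5 : ∀ m : ℕ, r ≤ m → PowerSeries.coeff m (cofE r i) = 0 := by
    intro m hm
    apply coeff_prod_eq_zero
    rw [Finset.card_erase_of_mem (mem_univ i), Finset.card_univ, Fintype.card_fin]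
    have := i.2
    omega
  have h6 : ∀ m : ℕ, ev r (h r ((a : ℤ) - m)) =
      if m ≤ a then PowerSeries.coeff (a - m) (PowerSeries.map (ev r).toRingHom (invE r)) else 0 := by
    intro m
    by_cases hm : m ≤ a
    · have : ((a : ℤ) - m).toNat = a - m := by omega
      rw [h, if_pos (by omega), this, if_pos hm, PowerSeries.coeff_map]
      rfl
    · rw [h, if_neg (by omega), if_neg hm, map_zero]
  rw [← Equiv.sum_comp Fin.revPerm]
  have h7 : ∀ m : Fin r, PowerSeries.coeff (r - 1 - (Fin.revPerm m).val) (cofE r i) *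
      ev r (h r ((a : ℤ) - (r - 1) + (Fin.revPerm m).val)) =
      PowerSeries.coeff m.val (cofE r i) * (if m.val ≤ a then
        PowerSeries.coeff (a - m.val) (PowerSeries.map (ev r).toRingHom (invE r)) else 0) := by
    intro m
    have hm := m.2
    rw [← h6, Fin.revPerm_apply, Fin.val_rev]
    congr 3
    · omega
    · omega
  rw [Finset.sum_congr rfl fun m _ => h7 m, Fin.sum_univ_eq_sum_range
    (fun m => PowerSeries.coeff m (cofE r i) * (if m ≤ a then
        PowerSeries.coeff (a - m) (PowerSeries.map (ev r).toRingHom (invE r)) else 0))]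
  have h8 : ∑ k ∈ range a.succ, PowerSeries.coeff k (cofE r i) *
        PowerSeries.coeff (a - k) (PowerSeries.map (ev r).toRingHom (invE r)) =
      ∑ m ∈ range a.succ, PowerSeries.coeff m (cofE r i) * (if m ≤ a then
        PowerSeries.coeff (a - m) (PowerSeries.map (ev r).toRingHom (invE r)) else 0) := by
    refine Finset.sum_congr rfl fun m hm => ?_
    rw [if_pos (Nat.lt_succ_iff.1 (mem_range.1 hm))]
  rw [h8]
  rcases le_total a.succ r with hr | hr
  · refine Finset.sum_subset (Finset.range_subset_range.2 hr) fun m _ hm => ?_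
    rw [mem_range, not_lt] at hm
    rw [if_neg (by omega), mul_zero]
  · refine (Finset.sum_subset (Finset.range_subset_range.2 hr) fun m _ hm => ?_).symm
    rw [mem_range, not_lt] at hm
    rw [h5 m hm, zero_mul]

/-- The transition matrix from `h` to powers of `y`. -/
def transL (r : ℕ) : Matrix (Fin r) (Fin r) (MvPolynomial (Fin r) ℚ) :=
  Matrix.of fun i m => PowerSeries.coeff (r - 1 - m.val) (cofE r i)

theorem det_pow_eq (r : ℕ) (a : Fin r → ℕ) :
    (Matrix.of fun i j : Fin r => (MvPolynomial.X i : MvPolynomial (Fin r) ℚ) ^ a j).det =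
      (transL r).det *
        ev r (Matrix.of fun i j : Fin r => h r ((a j : ℤ) - (r - 1) + i)).det := by
  rw [AlgHom.map_det, ← Matrix.det_mul]
  congr 1
  ext1 i j
  rw [Matrix.of_apply, pow_eq_sum, Matrix.mul_apply]
  rfl

theorem h_zero (r : ℕ) : h r 0 = 1 := by
  simp [h, invE]

theorem h_neg (r : ℕ) {n : ℤ} (hn : n < 0) : h r n = 0 := by
  rw [h, if_neg (by omega)]

theorem det_h_delta (r : ℕ) :
    (Matrix.of fun i j : Fin r => h r (((r - 1 - j.val : ℕ) : ℤ) - (r - 1) + i)).det = 1 := by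
  rw [Matrix.det_of_isLowerTriangular]
  · refine Finset.prod_eq_one fun i _ => ?_
    rw [Matrix.of_apply, ← h_zero r]
    congr 1
    have := i.2
    omega
  · intro i j hij
    rw [OrderDual.toDual_lt_toDual] at hij
    rw [Matrix.of_apply]
    apply h_neg
    have := j.2
    have : i.val < j.val := hij
    omega

theorem vandermonde_dvd (r : ℕ) (a : Fin r → ℕ) :
    (Matrix.of fun i j : Fin r => (MvPolynomial.X j : MvPolynomial (Fin r) ℚ) ^ i.val).det ∣
      (Matrix.of fun i j : Fin r => (MvPolynomial.X j : MvPolynomial (Fin r) ℚ) ^ a i).det := by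
  rw [← Matrix.det_transpose, ← Matrix.det_transpose (Matrix.of fun i j : Fin r => _ ^ a i)]
  change (Matrix.of fun i j : Fin r => (MvPolynomial.X i : MvPolynomial (Fin r) ℚ) ^ j.val).det ∣
    (Matrix.of fun i j : Fin r => (MvPolynomial.X i : MvPolynomial (Fin r) ℚ) ^ a j).det
  rw [det_pow_eq r a]
  apply Dvd.dvd.mul_right
  have h1 := det_pow_eq r (fun j => r - 1 - j.val)
  rw [det_h_delta, map_one, mul_one] at h1
  rw [← h1]
  have h2 : (Matrix.of fun i j : Fin r =>
      (MvPolynomial.X i : MvPolynomial (Fin r) ℚ) ^ (r - 1 - j.val)) =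
      (Matrix.of fun i j : Fin r => (MvPolynomial.X i : MvPolynomial (Fin r) ℚ) ^ j.val).submatrix
        id Fin.revPerm := by
    ext1 i j
    simp only [Matrix.of_apply, Matrix.submatrix_apply, id, Fin.revPerm_apply, Fin.val_rev]
    congr 1
    omega
  rw [h2, Matrix.det_permute']
  exact Dvd.intro_left _ rfl

theorem det_transL_ne_zero (r : ℕ) : (transL r).det ≠ 0 := by
  have h1 := det_pow_eq r (fun j => j.val)
  intro h0
  rw [h0, zero_mul] at h1
  exact (Matrix.det_vandermonde_ne_zero_iff.2 (MvPolynomial.X_injective (R := ℚ))) h1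

/-- The determinants `det (h_{a_j - (r - 1) + i})`. -/
def detH (r : ℕ) (a : Fin r → ℕ) : B r :=
  (Matrix.of fun i j : Fin r => h r ((a j : ℤ) - (r - 1) + i)).det

theorem coeff_alternant (r : ℕ) (a c : Fin r → ℕ) (ha : StrictMono a) (hc : StrictMono c) :
    MvPolynomial.coeff (Finsupp.equivFunOnFinite.symm c)
      (Matrix.of fun i j : Fin r => (MvPolynomial.X i : MvPolynomial (Fin r) ℚ) ^ a j).det =
      if a = c then 1 else 0 := by
  rw [← Matrix.det_transpose, Matrix.det_apply, MvPolynomial.coeff_sum]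
  have key : ∀ σ : Equiv.Perm (Fin r),
      ∏ i, (Matrix.of fun i j : Fin r =>
        (MvPolynomial.X i : MvPolynomial (Fin r) ℚ) ^ a j).transpose (σ i) i =
      MvPolynomial.monomial (Finsupp.equivFunOnFinite.symm (a ∘ σ)) 1 := by
    intro σ
    rw [MvPolynomial.monomial_eq, Finsupp.prod_fintype _ _ (by simp)]
    simp
  simp_rw [key, MvPolynomial.coeff_smul, MvPolynomial.coeff_monomial]
  rw [Finset.sum_eq_single 1]
  · simp [funext_iff]
  · intro σ _ hσ
    rw [if_neg, smul_zero]
    intro heq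
    have h1 : a ∘ σ = c := Finsupp.equivFunOnFinite.symm.injective heq
    apply hσ
    have h2 : StrictMono σ := by
      intro x y hxy
      have := hc hxy
      rw [← h1] at this
      exact ha.lt_iff_lt.1 this
    ext x
    have h3 : (σ : Fin r → Fin r) = id :=
      (StrictMono.range_inj h2 strictMono_id).1 (by simp [σ.surjective.range_eq])
    rw [h3]; rfl
  · simp

/-- The basis of `⋀^r V` formed by the wedges of the `b_n`. -/
def wedgeBasis (r : ℕ) : Module.Basis (Set.powersetCard ℕ r) ℚ (⋀[ℚ]^r V) :=
  (Finsupp.basisSingleOne (R := ℚ) (ι := ℕ)).exteriorPower r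

theorem toB_wedgeBasis (r : ℕ) (s : Set.powersetCard ℕ r) :
    toB r (wedgeBasis r s : Wedge) = detH r (Set.powersetCard.ofFinEmbEquiv.symm s) := by
  rw [wedgeBasis, exteriorPower.basis_apply, exteriorPower.ιMulti_family,
    exteriorPower.ιMulti_apply_coe, toB_ιMulti]
  rw [detH, ← altB_b]
  congr 1

theorem detH_mem_range (r : ℕ) (a : Fin r → ℕ) :
    detH r a ∈ LinearMap.range ((toB r).comp (⋀[ℚ]^r V).subtype) :=
  ⟨exteriorPower.ιMulti ℚ r fun j => b (a j), by
    rw [LinearMap.comp_apply, Submodule.subtype_apply, exteriorPower.ιMulti_apply_coe, toB_ιMulti,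
      altB_b, detH]⟩

theorem toB_injective (r : ℕ) :
    Function.Injective ((toB r).comp (⋀[ℚ]^r V).subtype) := by
  have hli : LinearIndependent ℚ
      (fun s => (toB r).comp (⋀[ℚ]^r V).subtype (wedgeBasis r s)) := by
    apply LinearIndependent.of_comp ((LinearMap.mulLeft ℚ (transL r).det).comp (ev r).toLinearMap)
    apply LinearIndependent.of_pairwise_dual_eq_zero_one _ (fun s => MvPolynomial.lcoeff ℚ
      (Finsupp.equivFunOnFinite.symm (Set.powersetCard.ofFinEmbEquiv.symm s : Fin r → ℕ)))
    · intro s t hst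
      have h1 := coeff_alternant r (Set.powersetCard.ofFinEmbEquiv.symm t)
        (Set.powersetCard.ofFinEmbEquiv.symm s) (OrderEmbedding.strictMono _)
        (OrderEmbedding.strictMono _)
      rw [det_pow_eq, if_neg] at h1
      · simpa [toB_wedgeBasis, detH] using h1
      · intro heq
        exact hst (Set.powersetCard.ofFinEmbEquiv.symm.injective (DFunLike.coe_injective heq.symm))
    · intro s
      have h1 := coeff_alternant r (Set.powersetCard.ofFinEmbEquiv.symm s)
        (Set.powersetCard.ofFinEmbEquiv.symm s) (OrderEmbedding.strictMono _)
        (OrderEmbedding.strictMono _)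
      rw [det_pow_eq, if_pos rfl] at h1
      simpa [toB_wedgeBasis, detH] using h1
  rw [← LinearMap.ker_eq_bot, LinearMap.ker_eq_bot']
  intro u hu
  have h1 := (wedgeBasis r).linearCombination_repr u
  rw [← h1, Finsupp.linearCombination_apply, Finsupp.sum, map_sum] at hu
  simp only [map_smul] at hu
  have h2 : (wedgeBasis r).repr u = 0 := (linearIndependent_iff.1 hli) _ (by
    rw [Finsupp.linearCombination_apply, Finsupp.sum]; exact hu)
  simpa using h2

theorem E_mul_detH (r : ℕ) (a : Fin r → ℕ) :
    E r * PowerSeries.C (detH r a) = (Matrix.of fun i j : Fin r =>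
      PowerSeries.C (h r ((a j : ℤ) - (r - 1) + i)) -
        PowerSeries.X * PowerSeries.C (h r (((a j + 1 : ℕ) : ℤ) - (r - 1) + i))).det := by
  have hinj : Function.Injective (PowerSeries.map (ev r).toRingHom) :=
    PowerSeries.map_injective _ (ev_injective r)
  apply hinj
  have hne : PowerSeries.C (transL r).det ≠ 0 := by
    rw [Ne, map_eq_zero_iff _ PowerSeries.C_injective]
    exact det_transL_ne_zero r
  apply mul_left_cancel₀ hne
  have h1 : PowerSeries.C (transL r).det * PowerSeries.map (ev r).toRingHom
      (PowerSeries.C (detH r a)) = PowerSeries.C (Matrix.of fun i j : Fin r =>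
        (MvPolynomial.X i : MvPolynomial (Fin r) ℚ) ^ a j).det := by
    rw [PowerSeries.map_C, ← map_mul, det_pow_eq]
    rfl
  rw [map_mul, map_ev_E, mul_left_comm, h1, RingHom.map_det, RingHom.map_det, RingHom.map_det,
    ← Matrix.det_mul, ← Matrix.det_mul_column]
  congr 1
  ext1 i j
  rw [Matrix.of_apply, Matrix.mul_apply, RingHom.mapMatrix_apply, Matrix.map_apply,
    Matrix.of_apply]
  have h2 : ∀ c : ℕ, PowerSeries.C ((MvPolynomial.X i : MvPolynomial (Fin r) ℚ) ^ c) =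
      ∑ m : Fin r, PowerSeries.C (transL r i m) *
        PowerSeries.C (ev r (h r ((c : ℤ) - (r - 1) + m))) := by
    intro c
    rw [pow_eq_sum, map_sum]
    refine Finset.sum_congr rfl fun m _ => ?_
    rw [map_mul]
    rfl
  have h3 : (1 - PowerSeries.C (MvPolynomial.X i) * PowerSeries.X) *
      PowerSeries.C ((MvPolynomial.X i : MvPolynomial (Fin r) ℚ) ^ a j) =
      PowerSeries.C ((MvPolynomial.X i : MvPolynomial (Fin r) ℚ) ^ a j) - PowerSeries.X *
        PowerSeries.C ((MvPolynomial.X i : MvPolynomial (Fin r) ℚ) ^ (a j + 1)) := by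
    rw [pow_succ, map_mul]
    ring
  rw [h3, h2, h2, Finset.mul_sum, ← Finset.sum_sub_distrib]
  refine Finset.sum_congr rfl fun m _ => ?_
  simp only [RingHom.mapMatrix_apply, Matrix.map_apply, Matrix.of_apply, map_sub, map_mul,
    PowerSeries.map_C, PowerSeries.map_X]
  change _ = _ * (PowerSeries.C (ev r _) - _ * PowerSeries.C (ev r _))
  ring

theorem X_mul_detH_mem (r : ℕ) (n : Fin r) (a : Fin r → ℕ) :
    MvPolynomial.X n * detH r a ∈ LinearMap.range ((toB r).comp (⋀[ℚ]^r V).subtype) := by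
  set R := LinearMap.range ((toB r).comp (⋀[ℚ]^r V).subtype) with hR
  have h1 : ∀ m, PowerSeries.coeff m (E r * PowerSeries.C (detH r a)) ∈ R := by
    intro m
    rw [E_mul_detH, ← Matrix.det_transpose]
    have h2 : (Matrix.of fun i j : Fin r =>
        PowerSeries.C (h r ((a j : ℤ) - (r - 1) + i)) -
        PowerSeries.X * PowerSeries.C (h r (((a j + 1 : ℕ) : ℤ) - (r - 1) + i))).transpose =
        (fun (j : Fin r) (i : Fin r) => PowerSeries.C (h r ((a j : ℤ) - (r - 1) + i))) +
        fun (j : Fin r) => (-PowerSeries.X : PowerSeries (B r)) •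
          fun i : Fin r => PowerSeries.C (h r (((a j + 1 : ℕ) : ℤ) - (r - 1) + i)) := by
      refine Matrix.ext fun j i => ?_
      simp [Matrix.transpose_apply, sub_eq_add_neg]
    rw [h2]
    change PowerSeries.coeff m (Matrix.detRowAlternating (_ + _)) ∈ R
    rw [AlternatingMap.map_add_univ, map_sum]
    refine Submodule.sum_mem _ fun S _ => ?_
    have h3 : Matrix.detRowAlternating (S.piecewise
        (fun (j : Fin r) (i : Fin r) => PowerSeries.C (h r ((a j : ℤ) - (r - 1) + i)))
        fun j => (-PowerSeries.X : PowerSeries (B r)) •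
          fun i : Fin r => PowerSeries.C (h r (((a j + 1 : ℕ) : ℤ) - (r - 1) + i))) =
        (-PowerSeries.X) ^ (univ \ S).card *
          PowerSeries.C (detH r fun j => if j ∈ S then a j else a j + 1) := by
      have h4 : (S.piecewise
          (fun (j : Fin r) (i : Fin r) => PowerSeries.C (h r ((a j : ℤ) - (r - 1) + i)))
          fun j => (-PowerSeries.X : PowerSeries (B r)) •
            fun i : Fin r => PowerSeries.C (h r (((a j + 1 : ℕ) : ℤ) - (r - 1) + i))) =
          fun j => (if j ∈ S then 1 else (-PowerSeries.X : PowerSeries (B r))) •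
            fun i : Fin r => PowerSeries.C
              (h r (((if j ∈ S then a j else a j + 1 : ℕ) : ℤ) - (r - 1) + i)) := by
        ext1 j
        by_cases hj : j ∈ S <;> simp [hj]
      rw [h4, AlternatingMap.map_smul_univ, Finset.prod_ite]
      rw [Finset.prod_const_one, one_mul, Finset.prod_const, smul_eq_mul]
      congr 1
      · congr 2
        ext j
        simp
      · rw [detH, RingHom.map_det, ← Matrix.det_transpose]
        rfl
    rw [h3, neg_pow, mul_assoc, mul_comm (PowerSeries.X ^ _), ← mul_assoc,
      PowerSeries.coeff_mul_X_pow']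
    split_ifs
    · rw [← map_one PowerSeries.C, ← map_neg, ← map_pow, ← map_mul, PowerSeries.coeff_C]
      split_ifs
      · rcases neg_one_pow_eq_or (B r) (univ \ S).card with h5 | h5 <;> rw [h5]
        · rw [one_mul]; exact detH_mem_range r _
        · rw [neg_one_mul]; exact Submodule.neg_mem _ (detH_mem_range r _)
      · exact Submodule.zero_mem _
    · exact Submodule.zero_mem _
  have h2 := h1 (n.val + 1)
  have h3 : PowerSeries.coeff (n.val + 1) (E r) = (-1) ^ (n.val + 1) * MvPolynomial.X n := by
    rw [E, map_add, PowerSeries.coeff_one, if_neg (by omega), zero_add, map_sum,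
      Finset.sum_eq_single n]
    · rw [← map_one PowerSeries.C, ← map_neg, ← map_pow, ← map_mul, PowerSeries.coeff_C_mul_X_pow,
        if_pos rfl]
    · intro i _ hi
      rw [← map_one PowerSeries.C, ← map_neg, ← map_pow, ← map_mul, PowerSeries.coeff_C_mul_X_pow,
        if_neg]
      intro h4
      exact hi (Fin.ext (by omega))
    · simp
  rw [PowerSeries.coeff_mul_C, h3] at h2
  rcases neg_one_pow_eq_or (B r) (n.val + 1) with h5 | h5 <;> rw [h5] at h2
  · rwa [one_mul] at h2
  · rw [neg_one_mul, neg_mul] at h2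
    exact (Submodule.neg_mem_iff _).1 h2

theorem toB_bijective (r : ℕ) :
    Function.Bijective ((toB r).comp (⋀[ℚ]^r V).subtype) := by
  refine ⟨toB_injective r, LinearMap.range_eq_top.1 ?_⟩
  have hX : ∀ (n : Fin r) (f : B r), f ∈ LinearMap.range ((toB r).comp (⋀[ℚ]^r V).subtype) →
      f * MvPolynomial.X n ∈ LinearMap.range ((toB r).comp (⋀[ℚ]^r V).subtype) := by
    rintro n _ ⟨u, rfl⟩
    rw [← (wedgeBasis r).linearCombination_repr u, Finsupp.linearCombination_apply, Finsupp.sum,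
      map_sum, Finset.sum_mul]
    refine Submodule.sum_mem _ fun s _ => ?_
    rw [map_smul, smul_mul_assoc]
    refine Submodule.smul_mem _ _ ?_
    rw [LinearMap.comp_apply, Submodule.subtype_apply, toB_wedgeBasis, mul_comm]
    exact X_mul_detH_mem r n _
  rw [eq_top_iff]
  intro f _
  have h1 : (1 : B r) ∈ LinearMap.range ((toB r).comp (⋀[ℚ]^r V).subtype) := by
    have := detH_mem_range r fun j => r - 1 - j.val
    rwa [detH, det_h_delta] at this
  induction f using MvPolynomial.induction_on with
  | C c =>
    have := Submodule.smul_mem _ c h1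
    rwa [MvPolynomial.smul_eq_C_mul, mul_one] at this
  | add p q hp hq => exact Submodule.add_mem _ (hp trivial) (hq trivial)
  | mul_X p n hp => exact hX n p (hp trivial)

/-- The linear isomorphism `B_r ≃ ⋀^r V` with `Δ_λ(H_r) ↦ [b]^r_λ`, i.e. `f ↦ f • [b]^r_0` for the
`B_r`-module structure of `⋀^r V`. -/
def fermion (r : ℕ) : B r ≃ₗ[ℚ] ⋀[ℚ]^r V :=
  (LinearEquiv.ofBijective ((toB r).comp (⋀[ℚ]^r V).subtype) (toB_bijective r)).symm

theorem fermion_schurDet {r : ℕ} (lam : Part r) : (fermion r (schurDet lam) : Wedge) = wedgeB lam := by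
  have h1 : fermion r (schurDet lam) =
      exteriorPower.ιMulti ℚ r fun j : Fin r => b (r - 1 - j + lam.1 j) := by
    rw [fermion, LinearEquiv.symm_apply_eq]
    rw [LinearEquiv.ofBijective_apply, LinearMap.comp_apply, Submodule.subtype_apply,
      exteriorPower.ιMulti_apply_coe, ← toB_wedgeB, wedgeB]
  rw [h1, exteriorPower.ιMulti_apply_coe, wedgeB]

/-! ### The operators `𝓔^k_{μν}` on `B_r` -/

/-- The contraction `[β]^k_ν ⌟ ·` with `[β]^k_ν = β_{k-1+ν_1} ∧ ⋯ ∧ β_{ν_k}`. As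
`η((α ∧ α') ⌟ u) = (α ∧ α' ∧ η)(u) = η(α' ⌟ (α ⌟ u))`, the factors are contracted from left to
right; hence `[β]^k_ν ⌟ [b]^k_μ = δ_{νμ}`. -/
def contraction {k : ℕ} (nu : Part k) : Wedge →ₗ[ℚ] Wedge :=
  (List.finRange k).foldl
    (fun T j => (CliffordAlgebra.contractLeft (beta (k - 1 - j + nu.1 j))).comp T) LinearMap.id

/-- The operator `𝓔^k_{μν}` on `B_r`, given by
`(𝓔^k_{μν} f) • [b]^r_0 = [b]^k_μ ∧ ([β]^k_ν ⌟ (f • [b]^r_0))`. -/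
def elemOp (r : ℕ) {k : ℕ} (mu nu : Part k) : B r →ₗ[ℚ] B r :=
  (toB r).comp ((LinearMap.mulLeft ℚ (wedgeB mu)).comp ((contraction nu).comp
    ((⋀[ℚ]^r V).subtype.comp (fermion r).toLinearMap)))

/-! ### Schur polynomials and the generating function `𝓔(z_k, w_k⁻¹)` -/

/-- The skew-symmetric polynomial `Δ_λ(x_1, …, x_k)`: row `i` is
`x_1^{i + λ_{k-i}}, …, x_k^{i + λ_{k-i}}`, for `0 ≤ i ≤ k - 1`. -/
def alternant {k : ℕ} (lam : Part k) : MvPolynomial (Fin k) ℚ :=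
  (Matrix.of fun i j : Fin k => (MvPolynomial.X j : MvPolynomial (Fin k) ℚ) ^
    (i.val + lam.1 i.rev)).det

/-- The Vandermonde determinant `Δ_0(x_1, …, x_k)`. -/
def vandermonde (k : ℕ) : MvPolynomial (Fin k) ℚ :=
  (Matrix.of fun i j : Fin k => (MvPolynomial.X j : MvPolynomial (Fin k) ℚ) ^ i.val).det

/-- The Schur polynomial `s_λ(x_1, …, x_k)`, the quotient of `Δ_λ` by `Δ_0`. -/
def schurPoly {k : ℕ} (lam : Part k) : MvPolynomial (Fin k) ℚ :=
  Classical.choose (vandermonde_dvd k fun i => i.val + lam.1 i.rev)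

theorem alternant_eq {k : ℕ} (lam : Part k) : alternant lam = vandermonde k * schurPoly lam :=
  Classical.choose_spec (vandermonde_dvd k fun i => i.val + lam.1 i.rev)

/-- The polynomial `s_μ(z_k) s_ν(w_k⁻¹)`, in the variables `z_j = X (inl j)` and
`w_j⁻¹ = X (inr j)`. -/
def schurPair {k : ℕ} (mu nu : Part k) : MvPolynomial (Fin k ⊕ Fin k) ℚ :=
  MvPolynomial.rename Sum.inl (schurPoly mu) * MvPolynomial.rename Sum.inr (schurPoly nu)

/-- `𝓔(z_k, w_k⁻¹) f = ∑_{μ,ν} s_μ(z_k) s_ν(w_k⁻¹) 𝓔^k_{μν} f`, a formal power series in the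
variables `z_j = X (inl j)` and `w_j⁻¹ = X (inr j)` with coefficients in `B_r`. -/
def genOp (r k : ℕ) (f : B r) : MvPowerSeries (Fin k ⊕ Fin k) (B r) :=
  fun a => ∑ᶠ p : Part k × Part k,
    MvPolynomial.coeff a (schurPair p.1 p.2) • elemOp r p.1 p.2 f

/-! ### Laurent series in `z_k` and `w_k⁻¹` -/

/-- `B_r⟦z_k, w_k⁻¹⟧[z_k⁻¹, w_k]`: formal Laurent series over `B_r` in the variables `z_j`
(exponents indexed by `inl j`) and `w_j⁻¹` (exponents indexed by `inr j`), with exponents bounded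
below; these are the Hahn series for the componentwise order on the exponents. -/
abbrev Laurent (r k : ℕ) : Type := HahnSeries (Fin k ⊕ Fin k → ℤ) (B r)

/-- The Laurent monomial `z_j ^ n`. -/
def zpw (r : ℕ) {k : ℕ} (j : Fin k) (n : ℤ) : Laurent r k :=
  HahnSeries.single (Pi.single (Sum.inl j) n) 1

/-- The Laurent monomial `w_j ^ n`. -/
def wpw (r : ℕ) {k : ℕ} (j : Fin k) (n : ℤ) : Laurent r k :=
  HahnSeries.single (Pi.single (Sum.inr j) (-n)) 1

/-- Vectors of natural numbers, as vectors of integers. -/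
def expHom (k : ℕ) : (Fin k ⊕ Fin k →₀ ℕ) →+ (Fin k ⊕ Fin k → ℤ) where
  toFun a i := (a i : ℤ)
  map_zero' := by ext i; simp
  map_add' a c := by ext i; simp

theorem expHom_injective (k : ℕ) : Function.Injective (expHom k) := by
  intro a c hac
  ext i
  have := congrFun hac i
  simpa [expHom] using this

theorem expHom_le (k : ℕ) (a c : Fin k ⊕ Fin k →₀ ℕ) : expHom k a ≤ expHom k c ↔ a ≤ c := by
  simp [expHom, Pi.le_def, Finsupp.le_def]

/-- The embedding `B_r⟦z_k, w_k⁻¹⟧ → B_r⟦z_k, w_k⁻¹⟧[z_k⁻¹, w_k]`. -/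
def toLaurent (r k : ℕ) : MvPowerSeries (Fin k ⊕ Fin k) (B r) →+* Laurent r k :=
  (HahnSeries.embDomainRingHom (expHom k) (expHom_injective k) (expHom_le k)).comp
  (HahnSeries.toMvPowerSeries (σ := Fin k ⊕ Fin k) (R := B r)).symm.toRingHom

/-! ### The Schubert derivation `σ̄_-(z)` -/

/-- `σ_{-1} : V → V`, with `b_n ↦ b_{n-1}` for `n ≥ 1` and `b_0 ↦ 0`. -/
def shiftDown : V →ₗ[ℚ] V :=
  Finsupp.linearCombination ℚ fun n : ℕ => if n = 0 then 0 else b (n - 1)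

/-- The Hasse–Schmidt derivation `σ̄_-(z)` of the exterior algebra, i.e. the multiplicative map
with `σ̄_-(z) v = v - σ_{-1}(v) z⁻¹` for `v ∈ V`; the polynomial variable is `z⁻¹`. -/
def sigmaBarMinus : Wedge →ₐ[ℚ] Polynomial Wedge :=
  ExteriorAlgebra.lift ℚ
    ⟨((Polynomial.monomial (R := Wedge) 0).restrictScalars ℚ).comp (ExteriorAlgebra.ι ℚ) -
      ((Polynomial.monomial (R := Wedge) 1).restrictScalars ℚ).comp
        ((ExteriorAlgebra.ι ℚ).comp shiftDown), by
      intro v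
      have h1 := ExteriorAlgebra.ι_sq_zero (R := ℚ) v
      have h2 := ExteriorAlgebra.ι_sq_zero (R := ℚ) (shiftDown v)
      have h3 := ExteriorAlgebra.ι_add_mul_swap (R := ℚ) v (shiftDown v)
      simp only [LinearMap.sub_apply, LinearMap.comp_apply, LinearMap.restrictScalars_apply,
        sub_mul, mul_sub, Polynomial.monomial_mul_monomial, h1, h2, map_zero, zero_sub, sub_zero,
        zero_add, add_zero]
      rw [← neg_add', ← map_add, add_comm, h3, map_zero, neg_zero]⟩

/-- The coefficient of `z^{-i}` in the map `σ̄_-(z) : B_r → B_r[z⁻¹]`, which is given by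
`(σ̄_-(z) f) • [b]^r_0 = σ̄_-(z) (f • [b]^r_0)`. -/
def sigmaBarCoeff (r i : ℕ) : B r →ₗ[ℚ] B r :=
  (toB r).comp ((((Polynomial.lcoeff Wedge i).restrictScalars ℚ).comp
    sigmaBarMinus.toLinearMap).comp ((⋀[ℚ]^r V).subtype.comp (fermion r).toLinearMap))

/-- The linear extension of `σ̄_-(z_j)` to Laurent series. On `B_r` the degree of `σ̄_-(z)` in
`z⁻¹` is at most `r`. -/
def sigmaBarVar {r k : ℕ} (j : Fin k) (F : Laurent r k) : Laurent r k :=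
  ∑ i ∈ range (r + 1), zpw r j (-(i : ℤ)) * F.map (sigmaBarCoeff r i)

/-- `σ̄_-(z_k) h_n = σ̄_-(z_1) ⋯ σ̄_-(z_k) h_n`. -/
def sigmaBarH (r k : ℕ) (n : ℤ) : Laurent r k :=
  (List.finRange k).foldr sigmaBarVar (HahnSeries.C (h r n))

/-- The determinant `Δ_λ(w_k⁻¹, σ̄_-(z_k) H_r)`: for `1 ≤ i, j ≤ r` the entry in row `i` and
column `j` is `w_i ^ (-(λ_j - j + i))` if `i ≤ k`, and `σ̄_-(z_k) h_{λ_j - j + i}` if `i > k`. -/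
def mixedDet {r : ℕ} (k : ℕ) (lam : Part r) : Laurent r k :=
  (Matrix.of fun i j : Fin r =>
    if hi : i.val < k then wpw r ⟨i.val, hi⟩ (-((lam.1 j : ℤ) - j + i))
    else sigmaBarH r k ((lam.1 j : ℤ) - j + i)).det

/-! ### Exponentials -/

/-- `exp (∑_{j ≥ 1} x_j z^j)`. -/
def expSeries {r : ℕ} (x : ℕ → B r) : PowerSeries (B r) :=
  (PowerSeries.exp (B r)).subst
    (PowerSeries.mk fun j => if j = 0 then 0 else x j : PowerSeries (B r))

/-- `∑_{j ≥ 1} x_j p_j(z_k)`, where `p_j(z_k) = z_1^j + ⋯ + z_k^j`; only `j ≤ |a|` contribute to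
the coefficient at the exponent `a`. -/
def powerSumSeries {r : ℕ} (k : ℕ) (x : ℕ → B r) : MvPowerSeries (Fin k ⊕ Fin k) (B r) :=
  fun a => ∑ j ∈ Icc 1 a.degree, x j *
    MvPowerSeries.coeff a (∑ i : Fin k, (MvPowerSeries.X (Sum.inl i)) ^ j)

/-- `exp (∑_{j ≥ 1} x_j p_j(z_k))`. -/
def expPowerSum {r : ℕ} (k : ℕ) (x : ℕ → B r) : MvPowerSeries (Fin k ⊕ Fin k) (B r) :=
  (PowerSeries.exp (B r)).subst (powerSumSeries k x)

/-- `∏_{j=1}^k 1 / E_r(z_j)`. -/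
def prodInvE (r k : ℕ) : MvPowerSeries (Fin k ⊕ Fin k) (B r) :=
  ∏ j : Fin k, (invE r).subst (MvPowerSeries.X (Sum.inl j) : MvPowerSeries (Fin k ⊕ Fin k) (B r))

end SchubertVertex

end

open SchubertVertex

noncomputable section

namespace SchubertVertex

open Finset

section

/-! ### Exponentials of power series -/

section Exp

variable {R : Type*} [CommRing R] [Algebra ℚ R]

/-! Write $V(z)=\det(z_j^{k-1-i})$. Multiplying $\mathcal E(\mathbf z_k,\mathbf w_k^{-1})$ by
$V(z)V(w^{-1})$ replaces each Schur polynomial by an alternant. The operators are antisymmetric in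
the exponents $k-j+\mu_j$ and $k-j+\nu_j$, so the sum over partitions unfolds to a sum over all
$e,c\in\mathbb N^k$ of $z^e w^{-c}\,b_{e_1}\wedge\cdots\wedge
b_{e_k}\wedge(\beta_{c_1}\wedge\cdots\wedge\beta_{c_k}\lrcorner u)$ (`sum_boundedParts_powDet_smul`,
`coeff_vandermondePair_mul_genOp`).

For the sum over $e$: under $\bigwedge^rV\cong B_r$ a wedge is a determinant in the $h_n$, and
summing the column of $b_{e_j}$ against $z_j^{e_j}$ gives $z_j^{r-1-i}/E_r(z_j)$ in row $i$ (counted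
from 0). The factors $1/E_r(z_j)$ come out. Combining rows with the coefficients of
$\prod_j(1-z_j^{-1}t)$ clears these columns from row $k$ on, because the polynomial vanishes at
$t=z_j$. The same combination turns $h_n$ into $\overline\sigma_-(\mathbf z_k)h_n$, since
$\overline\sigma_-(z)h_n=h_n-z^{-1}h_{n-1}$ (`sigmaBarCoeff_h`). The matrix is then block
triangular, with corner $\det(z_j^{r-1-l})=\prod_j z_j^{r-k}\,V(z)$ (`det_append_eq`,
`toLaurent_wedgeSeries`).

For the sum over $c$: by Laplace expansion, contracting with $\beta_c$ before applying a
determinantal form adds a top row to the determinant (`wedgeForm_contractMulti`). Summing the rows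
$\delta_{a_j,c_i}$ against $w_i^{-c_i}$ produces the rows $w_i^{-a_j}$ (`sum_mul_det_append`). Up to
powers of $w_i$ this is the mixed determinant. Cancelling $V(z)$, a nonzerodivisor, and factoring
$V(w^{-1})$ into a monomial times $\prod_{i<j}(1-w_i/w_j)$ gives the formula
(`prod_mul_toLaurent_genOp`).

The statements on the $x_j$ follow from logarithmic differentiation (`expSeries_eq_invE_iff`) and
from $\exp(f+g)=\exp f\exp g$. -/

theorem exp_subst_X_zero_add_X_one :
    (PowerSeries.exp R).subst
        (MvPowerSeries.X 0 + MvPowerSeries.X 1 : MvPowerSeries (Fin 2) R) =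
      (PowerSeries.exp R).subst (MvPowerSeries.X 0 : MvPowerSeries (Fin 2) R) *
        (PowerSeries.exp R).subst (MvPowerSeries.X 1 : MvPowerSeries (Fin 2) R) := by
  ext e
  rw [PowerSeries.coeff_subst_X_zero_add_X_one, PowerSeries.coeff_subst_X_zero_subst_mul_X_one,
    PowerSeries.coeff_exp, PowerSeries.coeff_exp, PowerSeries.coeff_exp, ← map_mul,
    ← map_natCast (algebraMap ℚ R), ← map_mul]
  congr 1
  -- Both coefficients equal $1/(e_0!\,e_1!)$; on the left it appears as a binomial coefficient over
  -- $(e_0+e_1)!$.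
  rw [Nat.cast_add_choose]
  have h0 := Nat.factorial_ne_zero (e 0)
  have h1 := Nat.factorial_ne_zero (e 1)
  have h2 := Nat.factorial_ne_zero (e 0 + e 1)
  field_simp

variable {σ : Type*}

/-- The identity in two free variables is universal: substitute $f$ and $g$ for them. -/
theorem exp_subst_add {f g : MvPowerSeries σ R} (hf : MvPowerSeries.constantCoeff f = 0)
    (hg : MvPowerSeries.constantCoeff g = 0) :
    (PowerSeries.exp R).subst (f + g) =
      (PowerSeries.exp R).subst f * (PowerSeries.exp R).subst g := by
  have hs : MvPowerSeries.HasSubst ![f, g] :=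
    MvPowerSeries.hasSubst_of_constantCoeff_zero fun i => by fin_cases i <;> simp [hf, hg]
  have hX : ∀ p : MvPowerSeries (Fin 2) R, MvPowerSeries.constantCoeff p = 0 →
      MvPowerSeries.subst ![f, g] ((PowerSeries.exp R).subst p) =
        (PowerSeries.exp R).subst (MvPowerSeries.subst ![f, g] p) := fun p hp =>
    MvPowerSeries.subst_comp_subst_apply (PowerSeries.HasSubst.of_constantCoeff_zero hp).const hs _
  have h1 := congrArg (MvPowerSeries.subst ![f, g]) (exp_subst_X_zero_add_X_one (R := R))
  rw [MvPowerSeries.subst_mul hs, hX _ (by simp), hX _ (by simp), hX _ (by simp),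
    MvPowerSeries.subst_add hs, MvPowerSeries.subst_X hs, MvPowerSeries.subst_X hs] at h1
  exact h1

theorem exp_subst_zero :
    (PowerSeries.exp R).subst (0 : MvPowerSeries σ R) = 1 := by
  rw [PowerSeries.subst_zero_eq_C_constantCoeff]
  simp

theorem exp_subst_sum {ι : Type*} (s : Finset ι) (f : ι → MvPowerSeries σ R)
    (hf : ∀ i, MvPowerSeries.constantCoeff (f i) = 0) :
    (PowerSeries.exp R).subst (∑ i ∈ s, f i) = ∏ i ∈ s, (PowerSeries.exp R).subst (f i) := by
  induction s using Finset.cons_induction with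
  | empty => simpa using exp_subst_zero
  | cons a s ha ih =>
    rw [Finset.sum_cons, Finset.prod_cons, exp_subst_add (hf a) (by simp [map_sum, hf]), ih]

theorem derivative_exp_subst {g : PowerSeries R} (hg : PowerSeries.constantCoeff g = 0) :
    PowerSeries.derivative R ((PowerSeries.exp R).subst g) =
      (PowerSeries.exp R).subst g * PowerSeries.derivative R g := by
  rw [PowerSeries.derivative_subst (PowerSeries.HasSubst.of_constantCoeff_zero' hg),
    PowerSeries.derivative_exp]

theorem constantCoeff_exp_subst {g : PowerSeries R} (hg : PowerSeries.constantCoeff g = 0) :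
    PowerSeries.constantCoeff ((PowerSeries.exp R).subst g) = 1 := by
  have h1 := PowerSeries.constantCoeff_subst_eq_zero (τ := Unit) (a := g) hg
    (PowerSeries.exp R - 1) (by simp)
  rw [PowerSeries.subst_sub (PowerSeries.HasSubst.of_constantCoeff_zero' hg), map_sub,
    ← PowerSeries.coe_substAlgHom (PowerSeries.HasSubst.of_constantCoeff_zero' hg), map_one,
    map_one, sub_eq_zero, PowerSeries.coe_substAlgHom] at h1
  exact h1

theorem exp_subst_neg_mul {g : PowerSeries R} (hg : PowerSeries.constantCoeff g = 0) :
    (PowerSeries.exp R).subst (-g) * (PowerSeries.exp R).subst g = 1 := by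
  have h1 := exp_subst_add (f := -g) (g := g) (R := R) (by
    rw [map_neg]; exact neg_eq_zero.2 hg) hg
  rw [neg_add_cancel, exp_subst_zero] at h1
  exact h1.symm

end Exp

/-! ### The variables `x_j` -/

variable {r : ℕ}

/-- `∑_{j ≥ 1} x_j z^j`. -/
def tailSeries (x : ℕ → B r) : PowerSeries (B r) := PowerSeries.mk fun j => if j = 0 then 0 else x j

theorem expSeries_eq (x : ℕ → B r) : expSeries x = (PowerSeries.exp (B r)).subst (tailSeries x) :=
  rfl

theorem constantCoeff_tailSeries (x : ℕ → B r) :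
    PowerSeries.constantCoeff (tailSeries x) = 0 := by
  rw [← PowerSeries.coeff_zero_eq_constantCoeff_apply, tailSeries, PowerSeries.coeff_mk, if_pos rfl]

theorem constantCoeff_invE : PowerSeries.constantCoeff (invE r) = 1 := by
  simp [invE]

/-- The right-hand side is the logarithmic derivative of $1/E_r$. For the converse, $G=\exp(-\sum
x_jz^j)$ is an explicit inverse of $F$, and $G/E_r$ has derivative $0$ and constant term $1$. -/
theorem expSeries_eq_invE_iff (x : ℕ → B r) :
    expSeries x = invE r ↔ PowerSeries.derivative (B r) (tailSeries x) =
      E r * PowerSeries.derivative (B r) (invE r) := by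
  have hc := constantCoeff_tailSeries x
  rw [expSeries_eq]
  constructor
  · intro hx
    have h1 := derivative_exp_subst hc
    rw [hx] at h1
    rw [h1, ← mul_assoc, E_mul_invE, one_mul]
  · intro hx
    set F := (PowerSeries.exp (B r)).subst (tailSeries x)
    set G := (PowerSeries.exp (B r)).subst (-tailSeries x)
    have hGF : G * F = 1 := exp_subst_neg_mul hc
    have hG : PowerSeries.derivative (B r) G =
        G * PowerSeries.derivative (B r) (-tailSeries x) :=
      derivative_exp_subst (by rw [map_neg, hc, neg_zero])
    have hc1 : PowerSeries.constantCoeff G = 1 :=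
      constantCoeff_exp_subst (by rw [map_neg, hc, neg_zero])
    have h1 : G * invE r = 1 := by
      apply PowerSeries.derivative.ext
      · rw [Derivation.leibniz, hG, map_neg, hx, smul_eq_mul, smul_eq_mul,
          ← map_one PowerSeries.C, PowerSeries.derivative_C]
        linear_combination (-G * PowerSeries.derivative (B r) (invE r)) * (E_mul_invE r)
      · rw [map_mul, hc1, constantCoeff_invE, map_one, one_mul]
    calc F = F * (G * invE r) := by rw [h1, mul_one]
      _ = (G * F) * invE r := by ring
      _ = invE r := by rw [hGF, one_mul]

/-- After logarithmic differentiation the equation is linear: its coefficient at $z^n$ prescribes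
$(n+1)x_{n+1}$, and $n+1$ is invertible in $B_r$. The series ignores $x_0$, which is why $x_0$ has
to be normalised. -/
theorem existsUnique_expSeries_eq_invE (r : ℕ) :
    ∃! x : ℕ → B r, x 0 = 0 ∧ expSeries x = invE r := by
  simp_rw [expSeries_eq_invE_iff]
  set D := E r * PowerSeries.derivative (B r) (invE r)
  have hco : ∀ (x : ℕ → B r) (n : ℕ), PowerSeries.coeff n
      (PowerSeries.derivative (B r) (tailSeries x)) = x (n + 1) * (n + 1) := by
    intro x n
    rw [PowerSeries.coeff_derivative, tailSeries, PowerSeries.coeff_mk, if_neg (by omega)]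
  have hq : ∀ n : ℕ, algebraMap ℚ (B r) ((n : ℚ) + 1)⁻¹ * ((n : B r) + 1) = 1 := by
    intro n
    have h1 : ((n : B r) + 1) = algebraMap ℚ (B r) ((n : ℚ) + 1) := by simp
    rw [h1, ← map_mul, inv_mul_cancel₀ (by positivity), map_one]
  refine ⟨fun j => if j = 0 then 0 else
    algebraMap ℚ (B r) (((j - 1 : ℕ) : ℚ) + 1)⁻¹ * PowerSeries.coeff (j - 1) D, ⟨by simp, ?_⟩, ?_⟩
  · ext1 n
    rw [hco, if_neg (by omega), Nat.add_sub_cancel]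
    linear_combination PowerSeries.coeff n D * hq n
  · rintro x ⟨h0, hx⟩
    funext j
    rcases j with _ | n
    · simpa using h0
    · have h1 := congrArg (PowerSeries.coeff n) hx
      rw [hco] at h1
      simp only [Nat.add_eq_zero_iff, one_ne_zero, and_false, if_false, Nat.add_sub_cancel]
      linear_combination algebraMap ℚ (B r) ((n : ℚ) + 1)⁻¹ * h1 - x (n + 1) * hq n

/-- The logarithmic derivative of $1-yz$ is $-y/(1-yz)=-\sum_n y^{n+1}z^n$; these add up over the
factors. -/
theorem derivative_prod_one_sub {A ι : Type*} [CommRing A] [DecidableEq ι] (y : ι → A)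
    (S : Finset ι) :
    PowerSeries.derivative A (∏ i ∈ S, (1 - PowerSeries.C (y i) * PowerSeries.X)) =
      -((∑ i ∈ S, PowerSeries.mk fun n => y i ^ (n + 1)) *
        ∏ i ∈ S, (1 - PowerSeries.C (y i) * PowerSeries.X)) := by
  induction S using Finset.induction_on with
  | empty => rw [Finset.prod_empty, Finset.sum_empty, zero_mul, neg_zero, PowerSeries.derivative_one]
  | insert a S ha ih =>
    have h1 : (PowerSeries.mk fun n => y a ^ (n + 1)) *
        (1 - PowerSeries.C (y a) * PowerSeries.X) = PowerSeries.C (y a) := by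
      ext n
      rw [mul_sub, mul_one, map_sub, ← mul_assoc, mul_comm _ (PowerSeries.C (y a)), mul_assoc,
        PowerSeries.coeff_C_mul]
      cases n with
      | zero => simp
      | succ n => rw [PowerSeries.coeff_succ_mul_X]; simp [pow_succ']
    have h2 : PowerSeries.derivative A (1 - PowerSeries.C (y a) * PowerSeries.X) =
        -PowerSeries.C (y a) := by
      rw [map_sub, Derivation.leibniz, PowerSeries.derivative_C, PowerSeries.derivative_X,
        ← map_one (PowerSeries.C (R := A)), PowerSeries.derivative_C]
      simp
    rw [Finset.prod_insert ha, Finset.sum_insert ha, Derivation.leibniz, ih, h2, smul_eq_mul,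
      smul_eq_mul]
    linear_combination (∏ i ∈ S, (1 - PowerSeries.C (y i) * PowerSeries.X)) * h1

theorem map_derivative {A A' : Type*} [CommRing A] [CommRing A'] (f : A →+* A')
    (p : PowerSeries A) : PowerSeries.map f (PowerSeries.derivative A p) =
      PowerSeries.derivative A' (PowerSeries.map f p) := by
  ext n
  simp [PowerSeries.coeff_derivative]

theorem natCast_mul_eq_powerSum {x : ℕ → B r} (hx : expSeries x = invE r)
    {A : Type*} [CommRing A] [Algebra (B r) A] (y : Fin r → A)
    (hy : PowerSeries.map (algebraMap (B r) A) (E r) =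
      ∏ i : Fin r, (1 - PowerSeries.C (y i) * PowerSeries.X)) {j : ℕ} (hj : 1 ≤ j) :
    (j : A) * algebraMap (B r) A (x j) = ∑ i : Fin r, y i ^ j := by
  classical
  obtain ⟨n, rfl⟩ : ∃ n, j = n + 1 := ⟨j - 1, by omega⟩
  rw [expSeries_eq_invE_iff] at hx
  -- Differentiating $E_r\cdot(1/E_r)=1$ trades the derivative of $1/E_r$ for that of $E_r$, which
  -- is the series known to split in $A$.
  have hdE : PowerSeries.derivative (B r) (E r) * invE r +
      E r * PowerSeries.derivative (B r) (invE r) = 0 := by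
    have := congrArg (PowerSeries.derivative (B r)) (E_mul_invE r)
    rw [Derivation.leibniz, ← map_one PowerSeries.C, PowerSeries.derivative_C, smul_eq_mul,
      smul_eq_mul] at this
    linear_combination this
  have h1 : PowerSeries.derivative (B r) (tailSeries x) =
      -(invE r * PowerSeries.derivative (B r) (E r)) := by
    linear_combination hx + hdE
  have h2 := congrArg (PowerSeries.map (algebraMap (B r) A)) h1
  have h3 := congrArg (PowerSeries.map (algebraMap (B r) A)) (E_mul_invE r)
  rw [map_mul, map_one] at h3
  rw [map_neg, map_mul, map_derivative (algebraMap (B r) A) (E r), hy,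
    derivative_prod_one_sub, ← hy] at h2
  have h4 : PowerSeries.map (algebraMap (B r) A) (PowerSeries.derivative (B r) (tailSeries x)) =
      ∑ i, PowerSeries.mk fun n => y i ^ (n + 1) := by
    linear_combination h2 + (∑ i, PowerSeries.mk fun n => y i ^ (n + 1)) * h3
  have h5 := congrArg (PowerSeries.coeff n) h4
  rw [PowerSeries.coeff_map, PowerSeries.coeff_derivative, tailSeries, PowerSeries.coeff_mk,
    if_neg (by omega), map_sum] at h5
  simp only [PowerSeries.coeff_mk, map_mul, map_add, map_natCast, map_one] at h5
  rw [← h5]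
  push_cast
  ring

/-- The cut-off $j\le|a|$ loses nothing: $z_i^j$ contributes at a single exponent, which has degree
exactly $j$. -/
theorem powerSumSeries_eq_sum (k : ℕ) (x : ℕ → B r) :
    powerSumSeries k x = ∑ i : Fin k, (tailSeries x).subst
      (MvPowerSeries.X (Sum.inl i) : MvPowerSeries (Fin k ⊕ Fin k) (B r)) := by
  classical
  ext1 a
  rw [map_sum]
  change ∑ j ∈ Icc 1 a.degree, x j * MvPowerSeries.coeff a
    (∑ i : Fin k, (MvPowerSeries.X (Sum.inl i)) ^ j) = _
  simp_rw [map_sum, Finset.mul_sum]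
  rw [Finset.sum_comm]
  refine Finset.sum_congr rfl fun i _ => ?_
  rw [PowerSeries.coeff_subst_single]
  simp_rw [MvPowerSeries.coeff_X_pow, tailSeries, PowerSeries.coeff_mk]
  by_cases ha : a = Finsupp.single (Sum.inl i) (a (Sum.inl i))
  · rw [if_pos ha]
    by_cases h0 : a (Sum.inl i) = 0
    · rw [if_pos h0]
      refine Finset.sum_eq_zero fun j hj => ?_
      rw [if_neg, mul_zero]
      intro h1
      rw [h1, Finsupp.single_eq_same] at h0
      simp [h0] at hj
    · rw [if_neg h0, Finset.sum_eq_single (a (Sum.inl i))]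
      · rw [if_pos ha, mul_one]
      · intro j _ hj
        rw [if_neg, mul_zero]
        intro h1
        apply hj
        rw [h1, Finsupp.single_eq_same]
      · intro h1
        exfalso
        apply h1
        rw [Finset.mem_Icc]
        refine ⟨by omega, ?_⟩
        conv_rhs => rw [ha]
        rw [Finsupp.degree_single]
  · rw [if_neg ha]
    refine Finset.sum_eq_zero fun j hj => ?_
    rw [if_neg, mul_zero]
    intro h1
    apply ha
    rw [h1, Finsupp.single_eq_same]

theorem prodInvE_eq_expPowerSum (k : ℕ) {x : ℕ → B r} (hx : expSeries x = invE r) :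
    prodInvE r k = expPowerSum k x := by
  have hX : ∀ i : Fin k, PowerSeries.HasSubst
      (MvPowerSeries.X (Sum.inl i) : MvPowerSeries (Fin k ⊕ Fin k) (B r)) := fun i =>
    PowerSeries.HasSubst.X _
  rw [expPowerSum, powerSumSeries_eq_sum, exp_subst_sum, prodInvE]
  · refine Finset.prod_congr rfl fun i _ => ?_
    rw [← hx, expSeries_eq]
    exact PowerSeries.subst_comp_subst_apply
      (PowerSeries.HasSubst.of_constantCoeff_zero' (constantCoeff_tailSeries x)) (hX i) _
  · intro i
    exact PowerSeries.constantCoeff_subst_eq_zero (by simp) _ (constantCoeff_tailSeries x)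

end

section

/-! ### Laurent monomials -/

/-- If the product with $F$ vanishes, the coefficients of $F$ are invariant under translation by
$g$, so a nonzero one at $a$ puts every $a+ng$ in the support. The support is partially well
ordered, hence $a+mg\le a+ng$ for some $m<n$, and $(n-m)g\ge0$. No hypothesis that $R$ is a domain
enters. -/
theorem one_sub_single_mem_nonZeroDivisors {Γ R : Type*} [AddCommGroup Γ] [PartialOrder Γ]
    [IsOrderedAddMonoid Γ] [CommRing R] (g : Γ) (hg : ∀ n : ℕ, 0 < n → ¬ 0 ≤ n • g) :
    (1 - HahnSeries.single g (1 : R) : HahnSeries Γ R) ∈ nonZeroDivisors (HahnSeries Γ R) := by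
  rw [mem_nonZeroDivisors_iff_left]
  intro F hF
  have h1 : ∀ a, F.coeff a = F.coeff (a - g) := by
    intro a
    have h2 := congrArg (fun G : HahnSeries Γ R => G.coeff a) hF
    simp only [sub_mul, one_mul, HahnSeries.coeff_sub, HahnSeries.coeff_single_mul,
      HahnSeries.coeff_zero] at h2
    exact sub_eq_zero.1 h2
  by_contra hne
  obtain ⟨a, ha⟩ : ∃ a, F.coeff a ≠ 0 := by
    by_contra! h
    exact hne (HahnSeries.ext (funext h))
  have h2 : ∀ n : ℕ, F.coeff (a + n • g) ≠ 0 := by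
    intro n
    induction n with
    | zero => simpa using ha
    | succ n ih =>
      rw [h1, succ_nsmul, ← add_assoc, add_sub_cancel_right]
      exact ih
  obtain ⟨m, n, hmn, hle⟩ := F.isPWO_support.exists_lt (f := fun n : ℕ => a + n • g)
    fun n => by simpa using h2 n
  apply hg (n - m) (by omega)
  have h3 : n • g = (n - m) • g + m • g := by
    rw [← add_nsmul, Nat.sub_add_cancel hmn.le]
  rw [add_le_add_iff_left, h3, le_add_iff_nonneg_left] at hle
  exact hle

variable {r k : ℕ}

theorem zpw_add (j : Fin k) (a c : ℤ) : zpw r j (a + c) = zpw r j a * zpw r j c := by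
  rw [zpw, zpw, zpw, HahnSeries.single_mul_single, ← Pi.single_add, one_mul]

theorem zpw_zero (j : Fin k) : zpw r j 0 = 1 := by
  rw [zpw, Pi.single_zero, HahnSeries.single_zero_one]

theorem wpw_add (j : Fin k) (a c : ℤ) : wpw r j (a + c) = wpw r j a * wpw r j c := by
  rw [wpw, wpw, wpw, HahnSeries.single_mul_single, ← Pi.single_add, one_mul, neg_add]

theorem wpw_zero (j : Fin k) : wpw r j 0 = 1 := by
  rw [wpw, neg_zero, Pi.single_zero, HahnSeries.single_zero_one]

theorem zpw_pow (j : Fin k) (a : ℤ) (n : ℕ) : zpw r j a ^ n = zpw r j (n * a) := by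
  induction n with
  | zero => simp [zpw_zero]
  | succ n ih => rw [pow_succ, ih, ← zpw_add]; congr 1; push_cast; ring

theorem wpw_pow (j : Fin k) (a : ℤ) (n : ℕ) : wpw r j a ^ n = wpw r j (n * a) := by
  induction n with
  | zero => simp [wpw_zero]
  | succ n ih => rw [pow_succ, ih, ← wpw_add]; congr 1; push_cast; ring

theorem isUnit_zpw (j : Fin k) (a : ℤ) : IsUnit (zpw r j a) :=
  IsUnit.of_mul_eq_one (zpw r j (-a)) (by rw [← zpw_add, add_neg_cancel, zpw_zero])

theorem one_sub_wpw_mem_nonZeroDivisors {i j : Fin k} (hij : i ≠ j) :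
    1 - wpw r i 1 * wpw r j (-1) ∈ nonZeroDivisors (Laurent r k) := by
  rw [wpw, wpw, HahnSeries.single_mul_single, one_mul]
  apply one_sub_single_mem_nonZeroDivisors
  intro n hn h0
  -- The exponents count powers of $w^{-1}$, so the negative coordinate of $w_i/w_j$ is the one at
  -- $i$; for $z_i/z_j$ it is the one at $j$.
  have := h0 (Sum.inr i)
  simp [hij] at this
  omega

theorem one_sub_zpw_mem_nonZeroDivisors {i j : Fin k} (hij : i ≠ j) :
    1 - zpw r i 1 * zpw r j (-1) ∈ nonZeroDivisors (Laurent r k) := by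
  rw [zpw, zpw, HahnSeries.single_mul_single, one_mul]
  apply one_sub_single_mem_nonZeroDivisors
  intro n hn h0
  have := h0 (Sum.inl j)
  simp [hij.symm] at this
  omega

theorem prod_one_sub_wpw_mem_nonZeroDivisors (r k : ℕ) :
    (∏ i : Fin k, ∏ j ∈ Finset.Ioi i, (1 - wpw r i 1 * wpw r j (-1))) ∈
      nonZeroDivisors (Laurent r k) :=
  Submonoid.prod_mem _ fun _ _ => Submonoid.prod_mem _ fun _ hj =>
    one_sub_wpw_mem_nonZeroDivisors (Finset.mem_Ioi.1 hj).ne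

/-! ### The embedding of power series into Laurent series -/

theorem toLaurent_injective (r k : ℕ) : Function.Injective (toLaurent r k) := by
  rw [toLaurent, RingHom.coe_comp]
  exact HahnSeries.embDomain_injective.comp HahnSeries.toMvPowerSeries.symm.injective

theorem toLaurent_monomial (e : Fin k ⊕ Fin k →₀ ℕ) (c : B r) :
    toLaurent r k (MvPowerSeries.monomial e c) = HahnSeries.single (expHom k e) c := by
  classical
  have h1 : HahnSeries.toMvPowerSeries.symm (MvPowerSeries.monomial e c) =
      HahnSeries.single e c := by
    refine HahnSeries.ext (funext fun a => ?_)
    rw [HahnSeries.coeff_toMvPowerSeries_symm, MvPowerSeries.coeff_monomial,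
      HahnSeries.coeff_single]
    congr
  change HahnSeries.embDomain _ (HahnSeries.toMvPowerSeries.symm _) = _
  rw [h1]
  exact HahnSeries.embDomain_single

theorem toLaurent_C (c : B r) : toLaurent r k (MvPowerSeries.C c) = HahnSeries.C c := by
  rw [← MvPowerSeries.monomial_zero_eq_C_apply, toLaurent_monomial, map_zero]
  rfl

theorem expHom_single (s : Fin k ⊕ Fin k) (n : ℕ) :
    expHom k (Finsupp.single s n) = Pi.single s (n : ℤ) := by
  classical
  ext t
  change ((Finsupp.single s n t : ℕ) : ℤ) = _
  rw [Finsupp.single_apply, Pi.single_apply]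
  by_cases h : s = t
  · rw [if_pos h, if_pos h.symm]
  · rw [if_neg h, if_neg (Ne.symm h), Nat.cast_zero]

theorem toLaurent_X_inl (j : Fin k) :
    toLaurent r k (MvPowerSeries.X (Sum.inl j)) = zpw r j 1 := by
  rw [MvPowerSeries.X, toLaurent_monomial, expHom_single, zpw, Nat.cast_one]

theorem toLaurent_X_inr (j : Fin k) :
    toLaurent r k (MvPowerSeries.X (Sum.inr j)) = wpw r j (-1) := by
  rw [MvPowerSeries.X, toLaurent_monomial, expHom_single, wpw, Nat.cast_one, neg_neg]

/-! ### Determinantal forms on the exterior algebra -/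

section DetForm

variable {A : Type*} [CommRing A] [Algebra ℚ A]

/-- The alternating form `(v_1, …, v_n) ↦ det (ρ_i(v_j))`. -/
def detForm {n : ℕ} (ρ : Fin n → V →ₗ[ℚ] A) : V [⋀^Fin n]→ₗ[ℚ] A where
  toFun v := (Matrix.of fun i j : Fin n => ρ i (v j)).det
  map_update_add' := by
    intro inst v j x y
    obtain rfl : inst = instDecidableEqFin n := Subsingleton.elim _ _
    have key : ∀ u, (Matrix.of fun i l : Fin n => ρ i (Function.update v j u l)) =
        (Matrix.of fun i l : Fin n => ρ i (v l)).updateCol j (fun i => ρ i u) := by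
      intro u
      ext i l : 2
      rcases eq_or_ne l j with rfl | hl <;> simp [*]
    rw [key, key, key, ← Matrix.det_updateCol_add]
    congr 2
    ext i
    simp
  map_update_smul' := by
    intro inst v j c x
    obtain rfl : inst = instDecidableEqFin n := Subsingleton.elim _ _
    have key : ∀ u, (Matrix.of fun i l : Fin n => ρ i (Function.update v j u l)) =
        (Matrix.of fun i l : Fin n => ρ i (v l)).updateCol j (fun i => ρ i u) := by
      intro u
      ext i l : 2
      rcases eq_or_ne l j with rfl | hl <;> simp [*]
    rw [key, key, Algebra.smul_def, ← Matrix.det_updateCol_smul]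
    congr 2
    ext i
    simp [Algebra.smul_def]
  map_eq_zero_of_eq' := by
    intro v i j hv hij
    exact Matrix.det_zero_of_column_eq hij fun l => by simp [hv]

theorem detForm_apply {n : ℕ} (ρ : Fin n → V →ₗ[ℚ] A) (v : Fin n → V) :
    detForm ρ v = (Matrix.of fun i j : Fin n => ρ i (v j)).det := rfl

/-- The linear form on the exterior algebra which is `det (ρ_i(v_j))` in degree `n` and zero in
the other degrees. -/
def wedgeForm {n : ℕ} (ρ : Fin n → V →ₗ[ℚ] A) : Wedge →ₗ[ℚ] A :=
  ExteriorAlgebra.liftAlternating (Pi.single n (detForm ρ))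

theorem wedgeForm_ιMulti {n : ℕ} (ρ : Fin n → V →ₗ[ℚ] A) (v : Fin n → V) :
    wedgeForm ρ (ExteriorAlgebra.ιMulti ℚ n v) =
      (Matrix.of fun i j : Fin n => ρ i (v j)).det := by
  rw [wedgeForm, ExteriorAlgebra.liftAlternating_apply_ιMulti, Pi.single_eq_same, detForm_apply]

theorem wedgeForm_ιMulti_of_ne {n m : ℕ} (hm : m ≠ n) (ρ : Fin n → V →ₗ[ℚ] A) (v : Fin m → V) :
    wedgeForm ρ (ExteriorAlgebra.ιMulti ℚ m v) = 0 := by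
  rw [wedgeForm, ExteriorAlgebra.liftAlternating_apply_ιMulti, Pi.single_eq_of_ne hm,
    AlternatingMap.zero_apply]

/-- Iterates the antiderivation rule $\varphi\lrcorner(v\wedge
u)=\varphi(v)u-v\wedge(\varphi\lrcorner u)$. The signs are those of a Laplace expansion along a top
row. -/
theorem contractLeft_ιMulti (φ : Module.Dual ℚ V) {n : ℕ} (v : Fin (n + 1) → V) :
    CliffordAlgebra.contractLeft φ (ExteriorAlgebra.ιMulti ℚ (n + 1) v : Wedge) =
      ∑ j : Fin (n + 1), ((-1) ^ (j : ℕ) * φ (v j)) •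
        ExteriorAlgebra.ιMulti ℚ n (fun i => v (j.succAbove i)) := by
  induction n with
  | zero =>
    rw [ExteriorAlgebra.ιMulti_succ_apply, ExteriorAlgebra.ιMulti_zero_apply, mul_one]
    rw [Fin.sum_univ_succ, Fin.sum_univ_zero, ExteriorAlgebra.ιMulti_zero_apply, add_zero,
      ← Algebra.algebraMap_eq_smul_one]
    simp
  | succ n ih =>
    rw [ExteriorAlgebra.ιMulti_succ_apply]
    refine (CliffordAlgebra.contractLeft_ι_mul (Q := (0 : QuadraticForm ℚ V)) φ (v 0) _).trans ?_
    have h1 := ih (Matrix.vecTail v)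
    rw [Fin.sum_univ_succ, h1, Finset.mul_sum, sub_eq_add_neg, ← Finset.sum_neg_distrib]
    congr 1
    · simp [Matrix.vecTail]; rfl
    · refine Finset.sum_congr rfl fun j _ => ?_
      rw [ExteriorAlgebra.ιMulti_succ_apply, mul_smul_comm, ← neg_smul]
      congr 1
      · simp [Matrix.vecTail, pow_succ]
      · rw [Fin.succ_succAbove_zero]
        congr 2
        funext i
        simp [Matrix.vecTail]

/-- Laplace expansion along the top row $\varphi(v_j)$. By linearity decomposable wedges suffice,
and outside degree $n+1$ both sides vanish. -/
theorem wedgeForm_cons_contractLeft (φ : Module.Dual ℚ V) {n : ℕ} (ρ : Fin (n + 1) → V →ₗ[ℚ] A)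
    (h0 : ∀ v, ρ 0 v = algebraMap ℚ A (φ v)) (u : Wedge) :
    wedgeForm (fun i : Fin n => ρ i.succ) (CliffordAlgebra.contractLeft φ u : Wedge) =
      wedgeForm ρ u := by
  suffices h : (wedgeForm fun i : Fin n => ρ i.succ).comp
      (CliffordAlgebra.contractLeft (Q := (0 : QuadraticForm ℚ V)) φ) = wedgeForm ρ from
    LinearMap.congr_fun h u
  apply ExteriorAlgebra.lhom_ext
  intro m
  ext v
  change wedgeForm _ (CliffordAlgebra.contractLeft φ (ExteriorAlgebra.ιMulti ℚ m v : Wedge)) =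
    wedgeForm ρ (ExteriorAlgebra.ιMulti ℚ m v)
  rcases m with _ | m
  · rw [wedgeForm_ιMulti_of_ne (by omega), ExteriorAlgebra.ιMulti_zero_apply]
    refine (congrArg _ (CliffordAlgebra.contractLeft_one (Q := (0 : QuadraticForm ℚ V)) φ)).trans ?_
    exact map_zero _
  · rw [contractLeft_ιMulti, map_sum]
    simp_rw [map_smul]
    rcases eq_or_ne m n with rfl | hmn
    · rw [wedgeForm_ιMulti, Matrix.det_succ_row_zero]
      refine Finset.sum_congr rfl fun j _ => ?_
      rw [wedgeForm_ιMulti, Algebra.smul_def, map_mul, Matrix.of_apply, h0, map_pow, map_neg,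
        map_one]
      rfl
    · rw [wedgeForm_ιMulti_of_ne (by omega)]
      exact Finset.sum_eq_zero fun j _ => by rw [wedgeForm_ιMulti_of_ne hmn, smul_zero]

/-- The contraction `φ_1 ∧ ⋯ ∧ φ_k ⌟ ·`. -/
def contractMulti {k : ℕ} (φ : Fin k → Module.Dual ℚ V) : Wedge →ₗ[ℚ] Wedge :=
  (List.finRange k).foldl (fun T j => (CliffordAlgebra.contractLeft (φ j)).comp T) LinearMap.id

theorem foldl_comp {ι M : Type*} [AddCommGroup M] [Module ℚ M] (f : ι → M →ₗ[ℚ] M) (l : List ι)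
    (T : M →ₗ[ℚ] M) : l.foldl (fun T j => (f j).comp T) T =
      (l.foldl (fun T j => (f j).comp T) LinearMap.id).comp T := by
  induction l generalizing T with
  | nil => simp
  | cons a l ih => rw [List.foldl_cons, List.foldl_cons, ih, ih ((f a).comp LinearMap.id)]; rfl

theorem contractMulti_succ {k : ℕ} (φ : Fin (k + 1) → Module.Dual ℚ V) (u : Wedge) :
    contractMulti φ u = contractMulti (fun j => φ j.succ)
      (CliffordAlgebra.contractLeft (φ 0) u) := by
  rw [contractMulti, List.finRange_succ, List.foldl_cons, List.foldl_map]
  rw [foldl_comp (fun j : Fin k =>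
    CliffordAlgebra.contractLeft (Q := (0 : QuadraticForm ℚ V)) (φ j.succ))]
  rfl

/-- Contracting from left to right stacks $\varphi_1,\dots,\varphi_k$ on top in this order, so no
sign appears. Keeping $N$ as a variable with an equation avoids casts in the induction. -/
theorem wedgeForm_contractMulti {k n : ℕ} (φ : Fin k → Module.Dual ℚ V) (ρ : Fin n → V →ₗ[ℚ] A)
    {N : ℕ} (hN : N = k + n) (τ : Fin N → V →ₗ[ℚ] A)
    (hφ : ∀ i : Fin k, ∀ v, τ ⟨i, by omega⟩ v = algebraMap ℚ A (φ i v))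
    (hρ : ∀ i : Fin n, τ ⟨k + i, by omega⟩ = ρ i) (u : Wedge) :
    wedgeForm ρ (contractMulti φ u) = wedgeForm τ u := by
  induction k generalizing N u with
  | zero =>
    obtain rfl : N = n := by omega
    have : τ = ρ := by
      funext i
      rw [← hρ]
      congr 1
      ext
      simp
    rw [this]
    rfl
  | succ k ih =>
    obtain ⟨N, rfl⟩ : ∃ N', N = N' + 1 := ⟨N - 1, by omega⟩
    rw [contractMulti_succ, ih (fun j => φ j.succ) (by omega) (fun i => τ i.succ) ?_ ?_,
      wedgeForm_cons_contractLeft (φ 0) τ]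
    · exact hφ 0
    · intro i v
      exact hφ i.succ v
    · intro i
      rw [← hρ]
      congr 1
      ext
      simp
      omega

end DetForm

end

section

/-! ### The action of `σ̄_-(z)` on the `h_n` -/

theorem fermion_toB (r : ℕ) (u : ⋀[ℚ]^r V) : fermion r (toB r (u : Wedge)) = u := by
  rw [fermion, LinearEquiv.symm_apply_eq, LinearEquiv.ofBijective_apply, LinearMap.comp_apply,
    Submodule.subtype_apply]

theorem fermion_toB_ιMulti (r : ℕ) (v : Fin r → V) :
    (fermion r (toB r (ExteriorAlgebra.ιMulti ℚ r v)) : Wedge) =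
      ExteriorAlgebra.ιMulti ℚ r v := by
  have h1 := fermion_toB r (exteriorPower.ιMulti ℚ r v)
  rw [exteriorPower.ιMulti_apply_coe] at h1
  rw [h1, exteriorPower.ιMulti_apply_coe]

theorem shiftDown_b_zero : shiftDown (b 0) = 0 := by
  simp [shiftDown, b]

theorem shiftDown_b_succ (n : ℕ) : shiftDown (b (n + 1)) = b n := by
  simp [shiftDown, b]

theorem sigmaBarMinus_ι (v : V) :
    sigmaBarMinus (ExteriorAlgebra.ι ℚ v) = Polynomial.monomial 0 (ExteriorAlgebra.ι ℚ v) -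
      Polynomial.monomial 1 (ExteriorAlgebra.ι ℚ (shiftDown v)) := by
  rw [sigmaBarMinus, ExteriorAlgebra.lift_ι_apply]
  rfl

/-- The wedge `b_{p-1} ∧ ⋯ ∧ b_0`. -/
def stair (p : ℕ) : Wedge := ExteriorAlgebra.ιMulti ℚ p fun j : Fin p => b (p - 1 - j)

theorem stair_succ (p : ℕ) : stair (p + 1) = ExteriorAlgebra.ι ℚ (b p) * stair p := by
  rw [stair, ExteriorAlgebra.ιMulti_succ_apply, stair]
  congr 2
  funext j
  simp only [Matrix.vecTail, Function.comp_apply, Fin.val_succ]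
  congr 1
  omega

theorem ι_mul_stair_of_lt {q p : ℕ} (hq : q < p) : ExteriorAlgebra.ι ℚ (b q) * stair p = 0 := by
  -- The vector $b_q$ already occurs in the staircase, at position $p-1-q$.
  rw [stair, ← ExteriorAlgebra.ι_mul_prod_list (R := ℚ)
    (fun j : Fin p => b (p - 1 - j)) ⟨p - 1 - q, by omega⟩, ExteriorAlgebra.ιMulti_apply]
  congr 3
  simp only
  omega

theorem sigmaBarMinus_ι_mul_stair (q p : ℕ)
    (hs : sigmaBarMinus (stair p) = Polynomial.monomial 0 (stair p)) :
    sigmaBarMinus (ExteriorAlgebra.ι ℚ (b q) * stair p) =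
      Polynomial.monomial 0 (ExteriorAlgebra.ι ℚ (b q) * stair p) -
        Polynomial.monomial 1 (ExteriorAlgebra.ι ℚ (shiftDown (b q)) * stair p) := by
  rw [map_mul, sigmaBarMinus_ι, hs, sub_mul, Polynomial.monomial_mul_monomial,
    Polynomial.monomial_mul_monomial]

/-- Shifting the leading factor down repeats the next factor, so the $z^{-1}$ term dies; for the
last factor $b_0$ the shift itself is zero. -/
theorem sigmaBarMinus_stair (p : ℕ) :
    sigmaBarMinus (stair p) = Polynomial.monomial 0 (stair p) := by
  induction p with
  | zero =>
    rw [stair, ExteriorAlgebra.ιMulti_zero_apply, map_one]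
    rfl
  | succ p ih =>
    rw [stair_succ, sigmaBarMinus_ι_mul_stair _ _ ih]
    rcases p with _ | p
    · simp [shiftDown_b_zero]
    · rw [shiftDown_b_succ, ι_mul_stair_of_lt (Nat.lt_succ_self p)]
      simp

/-- The determinant is lower triangular: the staircase columns have $h_0=1$ on the diagonal and
negative indices above it, and the corner entry is $h_{q-p}$. -/
theorem toB_ι_mul_stair (p q : ℕ) :
    toB (p + 1) (ExteriorAlgebra.ι ℚ (b q) * stair p) = h (p + 1) ((q : ℤ) - p) := by
  have h1 : ExteriorAlgebra.ι ℚ (b q) * stair p = ExteriorAlgebra.ιMulti ℚ (p + 1)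
      fun j => b ((Fin.cons q fun j : Fin p => p - 1 - j : Fin (p + 1) → ℕ) j) := by
    rw [ExteriorAlgebra.ιMulti_succ_apply]
    rfl
  rw [h1, toB_ιMulti, altB_b, Matrix.det_of_isLowerTriangular, Fin.prod_univ_succ]
  · rw [Finset.prod_eq_one, mul_one]
    · rw [Matrix.of_apply, Fin.cons_zero]
      congr 1
      simp
    · intro i _
      rw [Matrix.of_apply, Fin.cons_succ, ← h_zero (p + 1)]
      congr 1
      have := i.2
      simp
      omega
  · intro i j hij
    rw [OrderDual.toDual_lt_toDual] at hij
    rw [Matrix.of_apply]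
    apply h_neg
    have hij' : i.val < j.val := hij
    obtain ⟨j, rfl⟩ : ∃ j', j = Fin.succ j' := ⟨j.pred (by rintro rfl; simp at hij'), by simp⟩
    rw [Fin.cons_succ]
    rw [Fin.val_succ] at hij'
    push_cast
    omega

theorem ι_mul_stair_eq_ιMulti (p q : ℕ) :
    ExteriorAlgebra.ι ℚ (b q) * stair p = ExteriorAlgebra.ιMulti ℚ (p + 1)
      (Matrix.vecCons (b q) fun j : Fin p => b (p - 1 - j)) := by
  rw [ExteriorAlgebra.ιMulti_succ_apply]
  rfl

/-- For $n\ge0$, $h_n$ corresponds to $b_{n+p}$ wedged with a staircase that $\overline\sigma_-(z)$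
fixes, so only the first factor moves. Rank at least one is essential: for $r=0$ one has $h_1=0$ but
$h_0=1$. -/
theorem sigmaBarCoeff_h (p i : ℕ) (n : ℤ) : sigmaBarCoeff (p + 1) i (h (p + 1) n) =
    if i = 0 then h (p + 1) n else if i = 1 then -h (p + 1) (n - 1) else 0 := by
  rcases lt_or_ge n 0 with hn | hn
  · rw [h_neg _ hn, h_neg _ (by omega), map_zero]
    simp
  · obtain ⟨n, rfl⟩ := Int.eq_ofNat_of_zero_le hn
    have h1 : h (p + 1) (n : ℤ) =
        toB (p + 1) (ExteriorAlgebra.ι ℚ (b (n + p)) * stair p) := by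
      rw [toB_ι_mul_stair]
      congr 1
      push_cast
      ring
    have h2 : sigmaBarCoeff (p + 1) i (h (p + 1) n) = toB (p + 1) (Polynomial.coeff
        (sigmaBarMinus (ExteriorAlgebra.ι ℚ (b (n + p)) * stair p)) i) := by
      rw [h1, ι_mul_stair_eq_ιMulti]
      change toB (p + 1) (Polynomial.coeff (sigmaBarMinus
        (fermion (p + 1) (toB (p + 1) (ExteriorAlgebra.ιMulti ℚ (p + 1) _)) : Wedge)) i) = _
      rw [fermion_toB_ιMulti]
    have h3 : toB (p + 1) (ExteriorAlgebra.ι ℚ (shiftDown (b (n + p))) * stair p) =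
        h (p + 1) ((n : ℤ) - 1) := by
      obtain h0 | ⟨s, hs⟩ : n + p = 0 ∨ ∃ s, n + p = s + 1 := by
        rcases Nat.eq_zero_or_pos (n + p) with h0 | h0
        · exact Or.inl h0
        · exact Or.inr ⟨n + p - 1, by omega⟩
      · rw [h0, shiftDown_b_zero, map_zero, zero_mul, map_zero, h_neg]
        omega
      · rw [hs, shiftDown_b_succ, toB_ι_mul_stair]
        congr 1
        omega
    rw [h2, sigmaBarMinus_ι_mul_stair _ _ (sigmaBarMinus_stair p), Polynomial.coeff_sub,
      Polynomial.coeff_monomial, Polynomial.coeff_monomial, map_sub]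
    by_cases hi : i = 0
    · subst hi
      simp [h1]
    · rw [if_neg (Ne.symm hi), if_neg hi, map_zero, zero_sub]
      by_cases hi1 : i = 1
      · subst hi1
        simp [h3]
      · rw [if_neg (Ne.symm hi1), if_neg hi1, map_zero, neg_zero]

/-! ### Iterating $\overline\sigma_-$ over the variables $z_j$ -/

variable {r k : ℕ}

theorem map_single_mul {Γ : Type*} [AddCommGroup Γ] [PartialOrder Γ] [IsOrderedAddMonoid Γ]
    {R : Type*} [CommRing R] [Algebra ℚ R] (g : Γ) (F : HahnSeries Γ R) (φ : R →ₗ[ℚ] R) :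
    (HahnSeries.single g (1 : R) * F).map φ = HahnSeries.single g (1 : R) * F.map φ := by
  refine HahnSeries.ext (funext fun a => ?_)
  simp [HahnSeries.coeff_single_mul]

theorem sigmaBarVar_zpw_mul (j i : Fin k) (a : ℤ) (F : Laurent r k) :
    sigmaBarVar j (zpw r i a * F) = zpw r i a * sigmaBarVar j F := by
  rw [sigmaBarVar, sigmaBarVar, Finset.mul_sum]
  refine Finset.sum_congr rfl fun n _ => ?_
  rw [zpw, zpw, map_single_mul]
  ring

theorem sigmaBarVar_sub (j : Fin k) (F G : Laurent r k) :
    sigmaBarVar j (F - G) = sigmaBarVar j F - sigmaBarVar j G := by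
  rw [sigmaBarVar, sigmaBarVar, sigmaBarVar, ← Finset.sum_sub_distrib]
  refine Finset.sum_congr rfl fun n _ => ?_
  rw [← mul_sub]
  congr 1
  refine HahnSeries.ext (funext fun a => ?_)
  simp

theorem sigmaBarVar_C_h (hr : 0 < r) (j : Fin k) (n : ℤ) :
    sigmaBarVar j (HahnSeries.C (h r n)) =
      HahnSeries.C (h r n) - zpw r j (-1) * HahnSeries.C (h r (n - 1)) := by
  obtain ⟨p, rfl⟩ : ∃ p, r = p + 1 := ⟨r - 1, by omega⟩
  have h1 : ∀ i, (HahnSeries.C (h (p + 1) n) : Laurent (p + 1) k).map (sigmaBarCoeff (p + 1) i) =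
      HahnSeries.C (sigmaBarCoeff (p + 1) i (h (p + 1) n)) := by
    intro i
    refine HahnSeries.ext (funext fun a => ?_)
    simp only [HahnSeries.C_apply, HahnSeries.map_coeff, HahnSeries.coeff_single]
    split_ifs <;> simp
  rw [sigmaBarVar, Finset.sum_range_succ', Finset.sum_range_succ', Finset.sum_eq_zero]
  · rw [h1, h1, sigmaBarCoeff_h, sigmaBarCoeff_h]
    simp [zpw_zero]
    ring
  · intro i _
    rw [h1, sigmaBarCoeff_h, if_neg (by omega), if_neg (by omega), map_zero, mul_zero]

/-- In the fold $\overline\sigma_-(z_j)$ is applied last, to a Laurent series. Since it is additive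
and commutes with monomials in the $z_i$, it may be applied to $h_n$ first. -/
theorem foldr_sigmaBarVar_cons (hr : 0 < r) (j : Fin k) (l : List (Fin k)) (n : ℤ) :
    (j :: l).foldr sigmaBarVar (HahnSeries.C (h r n)) =
      l.foldr sigmaBarVar (HahnSeries.C (h r n)) -
        zpw r j (-1) * l.foldr sigmaBarVar (HahnSeries.C (h r (n - 1))) := by
  induction l generalizing j n with
  | nil => exact sigmaBarVar_C_h hr j n
  | cons i l ih =>
    rw [List.foldr_cons, ih i n, ih i (n - 1), sigmaBarVar_sub, sigmaBarVar_zpw_mul]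
    have h1 := ih j n
    have h2 := ih j (n - 1)
    rw [List.foldr_cons] at h1 h2
    rw [h1, h2]
    ring

/-- The polynomial `∏_{j ∈ l} (1 - z_j⁻¹ t)`. -/
def invZPoly (r : ℕ) {k : ℕ} (l : List (Fin k)) : Polynomial (Laurent r k) :=
  (l.map fun j => 1 - Polynomial.C (zpw r j (-1)) * Polynomial.X).prod

theorem invZPoly_cons (j : Fin k) (l : List (Fin k)) :
    invZPoly r (j :: l) =
      invZPoly r l - Polynomial.C (zpw r j (-1)) * (Polynomial.X * invZPoly r l) := by
  rw [invZPoly, List.map_cons, List.prod_cons, ← invZPoly]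
  ring

theorem coeff_zero_invZPoly (l : List (Fin k)) : (invZPoly r l).coeff 0 = 1 := by
  induction l with
  | nil => simp [invZPoly]
  | cons j l ih =>
    rw [invZPoly_cons, Polynomial.coeff_sub, ih, Polynomial.coeff_C_mul,
      Polynomial.coeff_X_mul_zero, mul_zero, sub_zero]

theorem coeff_invZPoly_of_lt {l : List (Fin k)} {n : ℕ} (hn : l.length < n) :
    (invZPoly r l).coeff n = 0 := by
  induction l generalizing n with
  | nil =>
    rw [invZPoly, List.map_nil, List.prod_nil, Polynomial.coeff_one, if_neg]
    simp at hn
    omega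
  | cons j l ih =>
    rw [List.length_cons] at hn
    obtain ⟨n, rfl⟩ : ∃ n', n = n' + 1 := ⟨n - 1, by omega⟩
    rw [invZPoly_cons, Polynomial.coeff_sub, Polynomial.coeff_C_mul, Polynomial.coeff_X_mul,
      ih (by omega), ih (by omega), mul_zero, sub_zero]

theorem eval_invZPoly {l : List (Fin k)} {j : Fin k} (hj : j ∈ l) :
    (invZPoly r l).eval (zpw r j 1) = 0 := by
  rw [invZPoly, Polynomial.eval_list_prod, List.map_map]
  apply List.prod_eq_zero
  rw [List.mem_map]
  refine ⟨j, hj, ?_⟩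
  simp [← zpw_add, zpw_zero]

theorem sum_sub_mul_sum {R : Type*} [CommRing R] (c d : ℕ → R) (t : R) (H : ℤ → R)
    (h0 : d 0 = c 0) (h1 : ∀ p, d (p + 1) = c (p + 1) - t * c p) (n : ℤ) (N : ℕ) :
    ∑ p ∈ range (N + 1 + 1), c p * H (n - p) - t * ∑ p ∈ range (N + 1), c p * H (n - 1 - p) =
      ∑ p ∈ range (N + 1 + 1), d p * H (n - p) := by
  rw [Finset.sum_range_succ' _ (N + 1), Finset.sum_range_succ' _ (N + 1), Finset.mul_sum, h0,
    add_sub_right_comm, ← Finset.sum_sub_distrib]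
  congr 1
  refine Finset.sum_congr rfl fun p _ => ?_
  have h2 : n - 1 - (p : ℤ) = n - ((p + 1 : ℕ) : ℤ) := by
    push_cast
    ring
  rw [h2, h1]
  ring

/-- On the sequence $(h_n)$, $\overline\sigma_-(z_j)$ acts as $1-z_j^{-1}S$ with $S$ the shift
$h_n\mapsto h_{n-1}$, so the composite is a polynomial in $S$. Any bound $N$ at least its degree is
allowed, so that $N$ can later be the row index. -/
theorem foldr_sigmaBarVar_eq_sum (hr : 0 < r) (l : List (Fin k)) (n : ℤ) (N : ℕ)
    (hN : l.length ≤ N) :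
    l.foldr sigmaBarVar (HahnSeries.C (h r n)) =
      ∑ p ∈ range (N + 1), (invZPoly r l).coeff p * HahnSeries.C (h r (n - p)) := by
  induction l generalizing n N with
  | nil =>
    rw [Finset.sum_range_succ', Finset.sum_eq_zero]
    · rw [coeff_zero_invZPoly]
      simp
    · intro p _
      rw [coeff_invZPoly_of_lt (by simp), zero_mul]
  | cons j l ih =>
    rw [List.length_cons] at hN
    obtain ⟨N, rfl⟩ : ∃ N', N = N' + 1 := ⟨N - 1, by omega⟩
    rw [foldr_sigmaBarVar_cons hr, ih n (N + 1) (by omega), ih (n - 1) N (by omega)]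
    refine sum_sub_mul_sum _ _ _ (fun m => HahnSeries.C (h r m)) ?_ (fun p => ?_) n N
    · rw [coeff_zero_invZPoly, coeff_zero_invZPoly]
    · rw [invZPoly_cons, Polynomial.coeff_sub, Polynomial.coeff_C_mul, Polynomial.coeff_X_mul]

/-- The coefficients of `∏_{j=1}^k (1 - z_j⁻¹ t)`. -/
def invZCoeff (r k p : ℕ) : Laurent r k := (invZPoly r (List.finRange k)).coeff p

theorem invZCoeff_zero (r k : ℕ) : invZCoeff r k 0 = 1 := coeff_zero_invZPoly _

theorem sigmaBarH_eq_sum (hr : 0 < r) (n : ℤ) {N : ℕ} (hN : k ≤ N) :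
    sigmaBarH r k n = ∑ p ∈ range (N + 1), invZCoeff r k p * HahnSeries.C (h r (n - p)) :=
  foldr_sigmaBarVar_eq_sum hr _ n N (by simpa using hN)

/-- The polynomial $\prod_i(1-z_i^{-1}t)$ has the root $t=z_j$. This is what clears the $z_j$
columns in the row reduction. -/
theorem sum_invZCoeff_mul_zpw (j : Fin k) {N : ℕ} (hN : k ≤ N) :
    ∑ p ∈ range (N + 1), invZCoeff r k p * zpw r j p = 0 := by
  have h1 := eval_invZPoly (r := r) (List.mem_finRange j)
  rw [Polynomial.eval_eq_sum_range' (n := N + 1)] at h1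
  · refine Eq.trans (Finset.sum_congr rfl fun p _ => ?_) h1
    rw [zpw_pow, mul_one]
    rfl
  · rw [Nat.lt_succ_iff, Polynomial.natDegree_le_iff_coeff_eq_zero]
    intro m hm
    exact coeff_invZPoly_of_lt (by simpa using hN.trans_lt hm)

end

section

/-! ### Alternants and Schur polynomials -/

variable {k : ℕ}

/-- The strictly decreasing sequence `k - 1 - j + μ_j` attached to a partition. -/
def decExp (mu : Part k) (j : Fin k) : ℕ := k - 1 - j + mu.1 j

theorem decExp_strictAnti (mu : Part k) : StrictAnti (decExp mu) := by
  intro i j hij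
  have h1 := mu.2 hij.le
  have h2 : i.val < j.val := hij
  have := j.2
  simp only [decExp]
  omega

theorem decExp_injective : Function.Injective (decExp (k := k)) := by
  intro mu nu hmn
  ext j
  have := congrFun hmn j
  simp only [decExp] at this
  omega

theorem add_sub_le_of_strictAnti {c : Fin k → ℕ} (hc : StrictAnti c) {i j : Fin k} (hij : i ≤ j) :
    c j + (j - i) ≤ c i := by
  obtain ⟨d, hd⟩ : ∃ d, j.val = i.val + d := ⟨j - i, by have : i.val ≤ j.val := hij; omega⟩
  induction d generalizing j with
  | zero =>
    obtain rfl : i = j := Fin.ext (by omega)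
    simp
  | succ d ih =>
    have hj := j.2
    have h1 := ih (j := ⟨i + d, by omega⟩) (by rw [Fin.le_def]; simp) rfl
    have h2 : c j < c ⟨i + d, by omega⟩ := hc (by rw [Fin.lt_def]; simp; omega)
    simp only at h1
    omega

theorem exists_decExp_eq {c : Fin k → ℕ} (hc : StrictAnti c) : ∃ mu : Part k, decExp mu = c := by
  refine ⟨⟨fun j => c j - (k - 1 - j), fun i j hij => ?_⟩, ?_⟩
  · have h1 := add_sub_le_of_strictAnti hc hij
    have h2 : i.val ≤ j.val := hij
    have := j.2
    simp only
    omega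
  · funext j
    have hj := j.2
    -- Comparison with the last entry gives $c_j\ge k-1-j$, so the truncated subtraction of the
    -- staircase is exact.
    have h1 := add_sub_le_of_strictAnti hc (i := j) (j := ⟨k - 1, by omega⟩)
      (by rw [Fin.le_def]; simp only; omega)
    simp only at h1
    simp only [decExp]
    omega

theorem exists_decExp_comp_eq {a : Fin k → ℕ} (ha : Function.Injective a) :
    ∃ (mu : Part k) (σ : Equiv.Perm (Fin k)), decExp mu ∘ σ = a := by
  have h1 : StrictMono (a ∘ Tuple.sort a) :=
    (Tuple.monotone_sort a).strictMono_of_injective (ha.comp (Tuple.sort a).injective)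
  obtain ⟨mu, hmu⟩ := exists_decExp_eq (h1.comp_strictAnti Fin.rev_strictAnti)
  refine ⟨mu, (Tuple.sort a).symm.trans Fin.revPerm, ?_⟩
  rw [hmu]
  funext j
  simp

/-- The permutation $\tau\sigma^{-1}$ preserves order, because both sequences strictly decrease, and
is therefore the identity. -/
theorem decExp_comp_unique {mu nu : Part k} {σ τ : Equiv.Perm (Fin k)}
    (hst : decExp mu ∘ σ = decExp nu ∘ τ) : mu = nu ∧ σ = τ := by
  have h1 : ∀ i, decExp mu i = decExp nu ((σ.symm.trans τ) i) := by
    intro i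
    have := congrFun hst (σ.symm i)
    simpa using this
  have h2 : StrictMono (σ.symm.trans τ) := by
    intro x y hxy
    have := decExp_strictAnti mu hxy
    rw [h1, h1] at this
    exact (decExp_strictAnti nu).lt_iff_gt.1 this
  have h3 : (σ.symm.trans τ : Fin k → Fin k) = id :=
    (StrictMono.range_inj h2 strictMono_id).1 (by simp)
  have h4 : σ = τ := by
    ext x
    have := congrFun h3 (σ x)
    simp at this
    rw [this]
  refine ⟨decExp_injective (funext fun i => ?_), h4⟩
  rw [h1, h3]
  rfl

/-- The determinant `det (x_j ^ {e_i})`. -/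
def powDet (e : Fin k → ℕ) : MvPolynomial (Fin k) ℚ :=
  (Matrix.of fun i j : Fin k => (MvPolynomial.X j : MvPolynomial (Fin k) ℚ) ^ e i).det

theorem powDet_eq_sum (e : Fin k → ℕ) :
    powDet e = ∑ σ : Equiv.Perm (Fin k), ((Equiv.Perm.sign σ : ℤ) : ℚ) •
      MvPolynomial.monomial (Finsupp.equivFunOnFinite.symm (e ∘ σ)) (1 : ℚ) := by
  rw [powDet, Matrix.det_apply']
  refine Finset.sum_congr rfl fun σ _ => ?_
  rw [MvPolynomial.monomial_eq, Finsupp.prod_fintype _ _ (by simp), MvPolynomial.smul_eq_C_mul]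
  simp

theorem coeff_powDet (e : Fin k → ℕ) (a : Fin k →₀ ℕ) :
    MvPolynomial.coeff a (powDet e) = ∑ σ : Equiv.Perm (Fin k),
      if e ∘ σ = a then ((Equiv.Perm.sign σ : ℤ) : ℚ) else 0 := by
  rw [powDet_eq_sum, MvPolynomial.coeff_sum]
  refine Finset.sum_congr rfl fun σ _ => ?_
  rw [MvPolynomial.coeff_smul, MvPolynomial.coeff_monomial, smul_eq_mul, mul_ite, mul_one, mul_zero]
  refine if_congr ?_ rfl rfl
  rw [← Finsupp.equivFunOnFinite.injective.eq_iff, Equiv.apply_symm_apply]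
  rfl

theorem isHomogeneous_powDet (e : Fin k → ℕ) : (powDet e).IsHomogeneous (∑ i, e i) := by
  rw [powDet_eq_sum]
  refine MvPolynomial.IsHomogeneous.sum _ _ _ fun σ _ => ?_
  rw [MvPolynomial.smul_eq_C_mul]
  refine MvPolynomial.IsHomogeneous.C_mul (MvPolynomial.isHomogeneous_monomial _ ?_) _
  rw [Finsupp.degree_eq_sum, ← Equiv.sum_comp σ e]
  rfl

theorem powDet_rev (e : Fin k → ℕ) :
    powDet (e ∘ Fin.rev) = ((Equiv.Perm.sign (Fin.revPerm (n := k)) : ℤ) : MvPolynomial (Fin k) ℚ) *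
      powDet e := by
  rw [powDet, powDet, ← Matrix.det_permute]
  rfl

/-- The decreasing Vandermonde determinant `det (x_j ^ {k - 1 - i})`. -/
def decVandermonde (k : ℕ) : MvPolynomial (Fin k) ℚ := powDet fun i => k - 1 - i

theorem alternant_eq_powDet (mu : Part k) : alternant mu = powDet (decExp mu ∘ Fin.rev) := by
  rw [alternant, powDet]
  congr 1
  ext1 i j
  rw [Matrix.of_apply, Matrix.of_apply, Function.comp_apply, decExp, Fin.val_rev]
  congr 2
  omega

theorem vandermonde_eq_powDet (k : ℕ) :
    vandermonde k = powDet ((fun i : Fin k => k - 1 - i) ∘ Fin.rev) := by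
  rw [vandermonde, powDet]
  congr 1
  ext1 i j
  rw [Matrix.of_apply, Matrix.of_apply, Function.comp_apply, Fin.val_rev]
  congr 1
  omega

/-- Reversing the rows changes the alternant and the Vandermonde determinant by the same sign, which
cancels. -/
theorem decVandermonde_mul_schurPoly (mu : Part k) :
    decVandermonde k * schurPoly mu = powDet (decExp mu) := by
  have h1 := alternant_eq mu
  rw [alternant_eq_powDet, vandermonde_eq_powDet, powDet_rev, powDet_rev, mul_assoc] at h1
  refine (mul_left_cancel₀ ?_ h1).symm
  rcases Int.units_eq_one_or (Equiv.Perm.sign (Fin.revPerm (n := k))) with h2 | h2 <;> simp [h2]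

theorem decVandermonde_ne_zero (k : ℕ) : decVandermonde k ≠ 0 := by
  intro h0
  have h1 : powDet ((fun i : Fin k => k - 1 - i) ∘ Fin.rev) = 0 := by
    rw [powDet_rev]
    exact mul_eq_zero_of_right _ h0
  rw [← vandermonde_eq_powDet, vandermonde, ← Matrix.det_transpose] at h1
  exact (Matrix.det_vandermonde_ne_zero_iff.2 (MvPolynomial.X_injective (R := ℚ))) h1

/-- The component of $pq$ in degree $m+i$ is $p\,q_i$; for $i\ne n$ it is zero, and $p$ cancels.
Applied to Schur polynomials, this bounds the partitions that contribute to a given monomial. -/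
theorem isHomogeneous_of_mul {σ R : Type*} [CommRing R] [IsDomain R] {p q : MvPolynomial σ R}
    {m n : ℕ} (hp : p.IsHomogeneous m) (hp0 : p ≠ 0) (hpq : (p * q).IsHomogeneous (m + n)) :
    q.IsHomogeneous n := by
  classical
  let := MvPolynomial.gradedAlgebra (σ := σ) (R := R)
  have h1 : ∀ i, i ≠ n → MvPolynomial.homogeneousComponent i q = 0 := by
    intro i hi
    have h2 := DirectSum.coe_decompose_mul_add_of_left_mem
      (MvPolynomial.homogeneousSubmodule σ R) (j := i) (b := q) hp
    rw [DirectSum.decompose_of_mem_ne (MvPolynomial.homogeneousSubmodule σ R) hpq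
      (show m + n ≠ m + i by omega)] at h2
    have h3 := (mul_eq_zero.1 h2.symm).resolve_left hp0
    rw [← MvPolynomial.decomposition.decompose'_apply]
    exact h3
  rw [← MvPolynomial.sum_homogeneousComponent q]
  refine MvPolynomial.IsHomogeneous.sum _ _ _ fun i _ => ?_
  rcases eq_or_ne i n with rfl | hi
  · exact MvPolynomial.homogeneousComponent_isHomogeneous _ _
  · rw [h1 i hi]
    exact MvPolynomial.isHomogeneous_zero _ _ _

theorem isHomogeneous_schurPoly (mu : Part k) :
    (schurPoly mu).IsHomogeneous (∑ j, mu.1 j) := by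
  refine isHomogeneous_of_mul (isHomogeneous_powDet _) (decVandermonde_ne_zero k) ?_
  rw [← decVandermonde, decVandermonde_mul_schurPoly, ← Finset.sum_add_distrib]
  exact isHomogeneous_powDet _

/-- The partitions with all parts at most `N`. -/
def boundedParts (k N : ℕ) : Finset (Part k) :=
  ((Set.finite_Iic (fun _ : Fin k => N)).preimage Subtype.val_injective.injOn).toFinset

theorem mem_boundedParts {N : ℕ} {mu : Part k} : mu ∈ boundedParts k N ↔ ∀ j, mu.1 j ≤ N := by
  simp [boundedParts, Pi.le_def]

/-- The coefficient of $x^a$ in an alternant is a sum of signs over the $\sigma$ that rearrange its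
exponents into $a$. If $a$ is injective, exactly one pair $(\mu,\sigma)$ occurs, and its sign turns
$g$ at the sorted sequence into $g(a)$; otherwise everything vanishes. -/
theorem sum_boundedParts_powDet_smul {M : Type*} [AddCommGroup M] [Module ℚ M]
    (g : (Fin k → ℕ) → M) (hg : ∀ c (σ : Equiv.Perm (Fin k)),
      g (c ∘ σ) = ((Equiv.Perm.sign σ : ℤ) : ℚ) • g c)
    (hg0 : ∀ c, ¬ Function.Injective c → g c = 0) (a : Fin k →₀ ℕ) {N : ℕ} (hN : ∀ j, a j ≤ N) :
    ∑ mu ∈ boundedParts k N, MvPolynomial.coeff a (powDet (decExp mu)) • g (decExp mu) = g a := by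
  have h1 : ∀ mu : Part k, MvPolynomial.coeff a (powDet (decExp mu)) • g (decExp mu) =
      ∑ σ : Equiv.Perm (Fin k), if decExp mu ∘ σ = a then g a else 0 := by
    intro mu
    rw [coeff_powDet, Finset.sum_smul]
    refine Finset.sum_congr rfl fun σ _ => ?_
    split_ifs with h
    · rw [← hg, h]
    · rw [zero_smul]
  by_cases ha : Function.Injective a
  · obtain ⟨mu, σ, hσ⟩ := exists_decExp_comp_eq ha
    rw [Finset.sum_eq_single mu, h1, Finset.sum_eq_single σ, if_pos hσ]
    · intro τ _ hτ
      rw [if_neg fun h => hτ (decExp_comp_unique (h.trans hσ.symm)).2]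
    · simp
    · intro nu _ hnu
      rw [h1]
      refine Finset.sum_eq_zero fun τ _ => ?_
      rw [if_neg fun h => hnu (decExp_comp_unique (h.trans hσ.symm)).1]
    · intro h2
      exfalso
      apply h2
      rw [mem_boundedParts]
      intro j
      have h3 := hN (σ.symm j)
      rw [← hσ] at h3
      simp only [Function.comp_apply, Equiv.apply_symm_apply, decExp] at h3
      omega
  · rw [hg0 _ ha]
    refine Finset.sum_eq_zero fun mu _ => ?_
    rw [h1]
    refine Finset.sum_eq_zero fun τ _ => ?_
    rw [hg0 _ ha, ite_self]

/-! ### The coefficients of `𝓔(z_k, w_k⁻¹)` -/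

/-- The exponents of the variables `z_j`. -/
def zPart (x : Fin k ⊕ Fin k →₀ ℕ) : Fin k →₀ ℕ :=
  Finsupp.equivFunOnFinite.symm fun j => x (Sum.inl j)

/-- The exponents of the variables `w_j⁻¹`. -/
def wPart (x : Fin k ⊕ Fin k →₀ ℕ) : Fin k →₀ ℕ :=
  Finsupp.equivFunOnFinite.symm fun j => x (Sum.inr j)

theorem coeff_rename_inl_mul_rename_inr {R : Type*} [CommSemiring R]
    (p q : MvPolynomial (Fin k) R) (x : Fin k ⊕ Fin k →₀ ℕ) :
    MvPolynomial.coeff x (MvPolynomial.rename Sum.inl p * MvPolynomial.rename Sum.inr q) =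
      MvPolynomial.coeff (zPart x) p * MvPolynomial.coeff (wPart x) q := by
  classical
  induction p using MvPolynomial.induction_on' with
  | add p₁ p₂ h₁ h₂ => rw [map_add, add_mul, MvPolynomial.coeff_add, h₁, h₂, MvPolynomial.coeff_add,
      add_mul]
  | monomial s c =>
    induction q using MvPolynomial.induction_on' with
    | add q₁ q₂ h₁ h₂ => rw [map_add, mul_add, MvPolynomial.coeff_add, h₁, h₂,
        MvPolynomial.coeff_add, mul_add]
    | monomial t d =>
      rw [MvPolynomial.rename_monomial, MvPolynomial.rename_monomial, MvPolynomial.monomial_mul,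
        MvPolynomial.coeff_monomial, MvPolynomial.coeff_monomial, MvPolynomial.coeff_monomial]
      have h1 : s.mapDomain Sum.inl + t.mapDomain Sum.inr = x ↔ s = zPart x ∧ t = wPart x := by
        have hl : ∀ j, (s.mapDomain Sum.inl + t.mapDomain Sum.inr : Fin k ⊕ Fin k →₀ ℕ)
            (Sum.inl j) = s j := by
          intro j
          rw [Finsupp.add_apply, Finsupp.mapDomain_apply Sum.inl_injective,
            Finsupp.mapDomain_of_notMem_range _ _ (by simp), add_zero]
        have hr : ∀ j, (s.mapDomain Sum.inl + t.mapDomain Sum.inr : Fin k ⊕ Fin k →₀ ℕ)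
            (Sum.inr j) = t j := by
          intro j
          rw [Finsupp.add_apply, Finsupp.mapDomain_apply Sum.inr_injective,
            Finsupp.mapDomain_of_notMem_range _ _ (by simp), zero_add]
        constructor
        · rintro rfl
          exact ⟨Finsupp.ext fun j => (hl j).symm, Finsupp.ext fun j => (hr j).symm⟩
        · rintro ⟨hs, ht⟩
          ext (j | j)
          · rw [hl, hs]; rfl
          · rw [hr, ht]; rfl
      rw [if_congr h1 rfl rfl]
      by_cases hs : s = zPart x <;> by_cases ht : t = wPart x <;> simp [hs, ht]

/-- By homogeneity $|\mu|$ and $|\nu|$ are the total exponents of the two groups of variables, each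
at most $kN$. -/
theorem mem_boundedParts_of_coeff_ne_zero {mu nu : Part k} {x : Fin k ⊕ Fin k →₀ ℕ} {N : ℕ}
    (hN : ∀ s, x s ≤ N) (hx : MvPolynomial.coeff x (schurPair mu nu) ≠ 0) :
    mu ∈ boundedParts k (k * N) ∧ nu ∈ boundedParts k (k * N) := by
  rw [schurPair, coeff_rename_inl_mul_rename_inr] at hx
  have key : ∀ (la : Part k) (a : Fin k →₀ ℕ), (∀ j, a j ≤ N) →
      MvPolynomial.coeff a (schurPoly la) ≠ 0 → la ∈ boundedParts k (k * N) := by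
    intro la a ha h0
    rw [mem_boundedParts]
    intro j
    have h1 : a.degree = ∑ j, la.1 j := by
      by_contra hne
      exact h0 ((isHomogeneous_schurPoly la).coeff_eq_zero hne)
    calc la.1 j ≤ ∑ j, la.1 j := Finset.single_le_sum (fun _ _ => Nat.zero_le _) (mem_univ j)
      _ = ∑ j, a j := by rw [← h1, Finsupp.degree_eq_sum]
      _ ≤ ∑ _j : Fin k, N := Finset.sum_le_sum fun j _ => ha j
      _ = k * N := by simp
  exact ⟨key mu _ (fun j => hN _) (left_ne_zero_of_mul hx),
    key nu _ (fun j => hN _) (right_ne_zero_of_mul hx)⟩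

theorem finite_schurPair_smul_elemOp (r : ℕ) (f : B r) (a : Fin k ⊕ Fin k →₀ ℕ) :
    {p : Part k × Part k |
      MvPolynomial.coeff a (schurPair p.1 p.2) • elemOp r p.1 p.2 f ≠ 0}.Finite := by
  refine (boundedParts k (k * a.degree) ×ˢ boundedParts k (k * a.degree)).finite_toSet.subset ?_
  intro p hp
  rw [Finset.mem_coe, Finset.mem_product]
  exact mem_boundedParts_of_coeff_ne_zero (fun s => Finsupp.le_degree s a)
    fun h0 => hp (by rw [h0, zero_smul])

theorem coeff_genOp (r : ℕ) (f : B r) {x : Fin k ⊕ Fin k →₀ ℕ} {N : ℕ} (hN : ∀ s, x s ≤ N) :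
    MvPowerSeries.coeff x (genOp r k f) =
      ∑ p ∈ boundedParts k (k * N) ×ˢ boundedParts k (k * N),
        MvPolynomial.coeff x (schurPair p.1 p.2) • elemOp r p.1 p.2 f := by
  refine finsum_eq_sum_of_support_subset _ fun p hp => ?_
  rw [Finset.mem_coe, Finset.mem_product]
  exact mem_boundedParts_of_coeff_ne_zero hN fun h0 => hp (by simp only [h0, zero_smul])

/-- A polynomial with rational coefficients, as a power series with coefficients in `B_r`. -/
def polySeries (r k : ℕ) :
    MvPolynomial (Fin k ⊕ Fin k) ℚ →+* MvPowerSeries (Fin k ⊕ Fin k) (B r) :=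
  MvPolynomial.coeToMvPowerSeries.ringHom.comp (MvPolynomial.map (algebraMap ℚ (B r)))

theorem coeff_polySeries (r : ℕ) (P : MvPolynomial (Fin k ⊕ Fin k) ℚ) (x : Fin k ⊕ Fin k →₀ ℕ) :
    MvPowerSeries.coeff x (polySeries r k P) = algebraMap ℚ (B r) (MvPolynomial.coeff x P) := by
  rw [← MvPolynomial.coeff_map, ← MvPolynomial.coeff_coe]
  rfl

/-- One finite box of partitions serves all exponents below $x$, so the convolution can be
interchanged with the sum over partitions. -/
theorem coeff_polySeries_mul_genOp (r : ℕ) (f : B r) (P : MvPolynomial (Fin k ⊕ Fin k) ℚ)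
    {x : Fin k ⊕ Fin k →₀ ℕ} {N : ℕ} (hN : ∀ s, x s ≤ N) :
    MvPowerSeries.coeff x (polySeries r k P * genOp r k f) =
      ∑ p ∈ boundedParts k (k * N) ×ˢ boundedParts k (k * N),
        MvPolynomial.coeff x (P * schurPair p.1 p.2) • elemOp r p.1 p.2 f := by
  classical
  simp_rw [MvPolynomial.coeff_mul, Finset.sum_smul]
  rw [MvPowerSeries.coeff_mul, Finset.sum_comm]
  refine Finset.sum_congr rfl fun q hq => ?_
  rw [Finset.HasAntidiagonal.mem_antidiagonal] at hq
  rw [coeff_polySeries, coeff_genOp r f (x := q.2) (N := N) fun s =>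
    le_trans (by rw [← hq]; simp) (hN s), Finset.mul_sum]
  refine Finset.sum_congr rfl fun p _ => ?_
  rw [← Algebra.smul_def, smul_smul]

/-- The product of the decreasing Vandermonde determinants in the `z_j` and in the `w_j⁻¹`. -/
def vandermondePair (k : ℕ) : MvPolynomial (Fin k ⊕ Fin k) ℚ :=
  MvPolynomial.rename Sum.inl (decVandermonde k) * MvPolynomial.rename Sum.inr (decVandermonde k)

theorem vandermondePair_mul_schurPair (mu nu : Part k) :
    vandermondePair k * schurPair mu nu =
      MvPolynomial.rename Sum.inl (powDet (decExp mu)) *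
        MvPolynomial.rename Sum.inr (powDet (decExp nu)) := by
  rw [vandermondePair, schurPair, ← decVandermonde_mul_schurPoly, ← decVandermonde_mul_schurPoly,
    map_mul, map_mul]
  ring

/-- Unfolds the sum over $\nu$, then the sum over $\mu$, by antisymmetry of $g$ in each argument. -/
theorem coeff_vandermondePair_mul_genOp (r : ℕ) (f : B r) (g : (Fin k → ℕ) → (Fin k → ℕ) → B r)
    (hg : ∀ mu nu : Part k, elemOp r mu nu f = g (decExp mu) (decExp nu))
    (h1 : ∀ a c (σ : Equiv.Perm (Fin k)), g (a ∘ σ) c = ((Equiv.Perm.sign σ : ℤ) : ℚ) • g a c)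
    (h2 : ∀ a c (σ : Equiv.Perm (Fin k)), g a (c ∘ σ) = ((Equiv.Perm.sign σ : ℤ) : ℚ) • g a c)
    (h1' : ∀ a c, ¬ Function.Injective a → g a c = 0)
    (h2' : ∀ a c, ¬ Function.Injective c → g a c = 0) (x : Fin k ⊕ Fin k →₀ ℕ) :
    MvPowerSeries.coeff x (polySeries r k (vandermondePair k) * genOp r k f) =
      g (zPart x) (wPart x) := by
  have hN : ∀ s, x s ≤ x.degree := fun s => Finsupp.le_degree s x
  -- The existence of a variable $s$ forces $k>0$.
  have hN' : ∀ s, x s ≤ k * x.degree := fun s => (hN s).trans (Nat.le_mul_of_pos_left _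
    (s.elim Fin.pos Fin.pos))
  rw [coeff_polySeries_mul_genOp r f _ hN, Finset.sum_product]
  simp_rw [vandermondePair_mul_schurPair, coeff_rename_inl_mul_rename_inr, hg, mul_smul,
    ← Finset.smul_sum]
  have h3 : ∀ a, ∑ nu ∈ boundedParts k (k * x.degree),
      MvPolynomial.coeff (wPart x) (powDet (decExp nu)) • g a (decExp nu) = g a (wPart x) :=
    fun a => sum_boundedParts_powDet_smul (g a) (h2 a) (h2' a) (wPart x) fun j => hN' _
  simp_rw [h3]
  exact sum_boundedParts_powDet_smul (fun a => g a (wPart x)) (fun a σ => h1 a _ σ)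
    (fun a ha => h1' a _ ha) (zPart x) fun j => hN' _

end

section

/-! ### The generating function of `b_{a_1} ∧ ⋯ ∧ b_{a_k} ∧ u` -/

variable {k : ℕ}

/-- The linear form on `V` with `b_n ↦ h_{n - (r - 1) + l}`. -/
def hForm (r l : ℕ) : V →ₗ[ℚ] B r :=
  Finsupp.linearCombination ℚ fun n : ℕ => h r ((n : ℤ) - (r - 1) + l)

theorem hForm_b (r l n : ℕ) : hForm r l (b n) = h r ((n : ℤ) - (r - 1) + l) := by
  simp [hForm, b]

theorem altB_apply (r : ℕ) (v : Fin r → V) :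
    altB r v = (Matrix.of fun i j : Fin r => hForm r i (v j)).det := by
  change (Matrix.of fun i j : Fin r => _).det = _
  congr 1
  ext1 i j
  rw [Matrix.of_apply, Matrix.of_apply, hForm, Finsupp.linearCombination_apply,
    Finsupp.linearCombination_apply, Finsupp.sum, Finsupp.sum, Finset.sum_apply]
  rfl

theorem toB_ιMulti_of_ne {r n : ℕ} (hn : n ≠ r) (v : Fin n → V) :
    toB r (ExteriorAlgebra.ιMulti ℚ n v) = 0 := by
  rw [toB, ExteriorAlgebra.liftAlternating_apply_ιMulti, Pi.single_eq_of_ne hn,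
    AlternatingMap.zero_apply]

/-- The power series `∑_a z^a (b_{a_1} ∧ ⋯ ∧ b_{a_k} ∧ u)`, transported to `B_r`. -/
def wedgeSeries (r k : ℕ) : Wedge →ₗ[ℚ] MvPowerSeries (Fin k ⊕ Fin k) (B r) :=
  LinearMap.pi fun x : Fin k ⊕ Fin k →₀ ℕ => if wPart x = 0 then (toB r).comp
    (LinearMap.mulLeft ℚ (ExteriorAlgebra.ιMulti ℚ k fun j => b (zPart x j))) else 0

theorem coeff_wedgeSeries (r : ℕ) (u : Wedge) (x : Fin k ⊕ Fin k →₀ ℕ) :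
    MvPowerSeries.coeff x (wedgeSeries r k u) = if wPart x = 0 then
      toB r ((ExteriorAlgebra.ιMulti ℚ k fun j => b (zPart x j)) * u) else 0 := by
  change (if wPart x = 0 then (toB r).comp (LinearMap.mulLeft ℚ
    (ExteriorAlgebra.ιMulti ℚ k fun j => b (zPart x j))) else 0) u = _
  split_ifs <;> rfl

/-- The factors involve distinct variables, so at most one splitting of the exponent $x$
contributes. -/
theorem coeff_prod_subst_X {R : Type*} [CommRing R] (f : Fin k → PowerSeries R)
    (x : Fin k ⊕ Fin k →₀ ℕ) :
    MvPowerSeries.coeff x (∏ j, (f j).subst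
      (MvPowerSeries.X (Sum.inl j) : MvPowerSeries (Fin k ⊕ Fin k) R)) =
      if wPart x = 0 then ∏ j, PowerSeries.coeff (zPart x j) (f j) else 0 := by
  classical
  rw [MvPowerSeries.coeff_prod]
  have h1 : ∀ l : Fin k →₀ (Fin k ⊕ Fin k →₀ ℕ), l ∈ finsuppAntidiag univ x →
      ∏ j, MvPowerSeries.coeff (l j) ((f j).subst
        (MvPowerSeries.X (Sum.inl j) : MvPowerSeries (Fin k ⊕ Fin k) R)) ≠ 0 →
      wPart x = 0 ∧ ∀ j, l j = Finsupp.single (Sum.inl j) (zPart x j) := by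
    intro l hl hne
    rw [Finset.mem_finsuppAntidiag] at hl
    have h2 : ∀ j, l j = Finsupp.single (Sum.inl j) (l j (Sum.inl j)) := by
      intro j
      by_contra h3
      refine hne (Finset.prod_eq_zero (mem_univ j) ?_)
      rw [PowerSeries.coeff_subst_single, if_neg h3]
    have h3 : ∀ s, x s = ∑ j, l j s := by
      intro s
      rw [← hl.1, Finsupp.finsetSum_apply]
    constructor
    · ext i
      change x (Sum.inr i) = 0
      rw [h3]
      refine Finset.sum_eq_zero fun j _ => ?_
      rw [h2 j]
      simp
    · intro j
      rw [h2 j]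
      congr 1
      change _ = x (Sum.inl j)
      rw [h3, Finset.sum_eq_single j]
      · intro i _ hij
        rw [h2 i, Finsupp.single_apply, if_neg]
        simpa using hij
      · simp
  split_ifs with hw
  · set l₀ : Fin k →₀ (Fin k ⊕ Fin k →₀ ℕ) :=
      Finsupp.equivFunOnFinite.symm fun j => Finsupp.single (Sum.inl j) (zPart x j) with hl₀
    rw [Finset.sum_eq_single l₀]
    · refine Finset.prod_congr rfl fun j _ => ?_
      rw [PowerSeries.coeff_subst_single]
      simp [hl₀]
    · intro l hl hne
      by_contra h0
      exact hne (Finsupp.ext fun j => (h1 l hl h0).2 j)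
    · intro h0
      exfalso
      apply h0
      rw [Finset.mem_finsuppAntidiag]
      refine ⟨?_, by simp⟩
      ext (i | i)
      · rw [Finsupp.finsetSum_apply, Finset.sum_eq_single i]
        · simp [hl₀]
          rfl
        · intro j _ hij
          simp [hl₀, hij]
        · simp
      · rw [Finsupp.finsetSum_apply]
        refine (Finset.sum_eq_zero fun j _ => ?_).trans (DFunLike.congr_fun hw i).symm
        simp [hl₀]
  · refine Finset.sum_eq_zero fun l hl => ?_
    by_contra h0
    exact hw (h1 l hl h0).1

/-- The series `∑_n h_{n - (r - 1) + l} z^n`. -/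
def hSeries (r l : ℕ) : PowerSeries (B r) := PowerSeries.mk fun n => h r ((n : ℤ) - (r - 1) + l)

/-- For $l<r$ the index shift is a multiplication by $z^{r-1-l}$. Hence all rows of a column share
the factor $1/E_r(z)$. -/
theorem hSeries_eq {r l : ℕ} (hl : l < r) :
    hSeries r l = PowerSeries.X ^ (r - 1 - l) * invE r := by
  ext1 n
  rw [PowerSeries.coeff_X_pow_mul', hSeries, PowerSeries.coeff_mk, h]
  by_cases hn : r - 1 - l ≤ n
  · rw [if_pos (by omega), if_pos hn]
    congr 2
    omega
  · rw [if_neg (by omega), if_neg hn]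

/-- In each term of the Leibniz formula $z_j$ occurs only in the entry from column $j$, so
extracting the coefficient of $z^e$ replaces that column by the one of $b_{e_j}$. -/
theorem wedgeSeries_ιMulti (m : ℕ) (v : Fin m → V) :
    wedgeSeries (k + m) k (ExteriorAlgebra.ιMulti ℚ m v) =
      (Matrix.of fun i : Fin (k + m) => Fin.append
        (fun j : Fin k => (hSeries (k + m) i).subst
          (MvPowerSeries.X (Sum.inl j) : MvPowerSeries (Fin k ⊕ Fin k) (B (k + m))))
        (fun j : Fin m => MvPowerSeries.C (hForm (k + m) i (v j)))).det := by
  ext1 x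
  rw [coeff_wedgeSeries, Matrix.det_apply', map_sum]
  have h1 : ∀ σ : Equiv.Perm (Fin (k + m)), MvPowerSeries.coeff x
      (((Equiv.Perm.sign σ : ℤ) : MvPowerSeries (Fin k ⊕ Fin k) (B (k + m))) *
        ∏ j, (Matrix.of fun i : Fin (k + m) => Fin.append
        (fun j : Fin k => (hSeries (k + m) i).subst
          (MvPowerSeries.X (Sum.inl j) : MvPowerSeries (Fin k ⊕ Fin k) (B (k + m))))
        (fun j : Fin m => MvPowerSeries.C (hForm (k + m) i (v j)))) (σ j) j) =
      if wPart x = 0 then ((Equiv.Perm.sign σ : ℤ) : B (k + m)) * ((∏ j : Fin k,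
        PowerSeries.coeff (zPart x j) (hSeries (k + m) (σ (Fin.castAdd m j)))) *
        ∏ j : Fin m, hForm (k + m) (σ (Fin.natAdd k j)) (v j)) else 0 := by
    intro σ
    rw [Fin.prod_univ_add]
    simp only [Matrix.of_apply, Fin.append_left, Fin.append_right]
    rw [← map_prod, ← map_intCast (MvPowerSeries.C (σ := Fin k ⊕ Fin k) (R := B (k + m))),
      MvPowerSeries.coeff_C_mul, MvPowerSeries.coeff_mul_C, coeff_prod_subst_X]
    split_ifs
    · rfl
    · rw [zero_mul, mul_zero]
  rw [Finset.sum_congr rfl fun σ _ => h1 σ]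
  split_ifs
  · rw [ExteriorAlgebra.ιMulti_mul_ιMulti, toB_ιMulti, altB_apply, Matrix.det_apply']
    refine Finset.sum_congr rfl fun σ _ => ?_
    rw [Fin.prod_univ_add]
    simp only [Matrix.of_apply, Fin.append_left, Fin.append_right, hForm_b, hSeries,
      PowerSeries.coeff_mk]
  · rw [Finset.sum_const_zero]

/-! ### Row operations -/

/-- The linear form on `V` with `b_n ↦ σ̄_-(z_k) h_{n - (r - 1) + l}`. -/
def sigmaForm (r k l : ℕ) : V →ₗ[ℚ] Laurent r k :=
  Finsupp.linearCombination ℚ fun n : ℕ => sigmaBarH r k ((n : ℤ) - (r - 1) + l)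

theorem sigmaForm_b (r k l n : ℕ) :
    sigmaForm r k l (b n) = sigmaBarH r k ((n : ℤ) - (r - 1) + l) := by
  simp [sigmaForm, b]

theorem C_smul_rat {r : ℕ} (c : ℚ) (f : B r) :
    (HahnSeries.C (c • f) : Laurent r k) = c • HahnSeries.C f := by
  rw [HahnSeries.C_apply, HahnSeries.C_apply]
  refine HahnSeries.ext (funext fun a => ?_)
  simp only [HahnSeries.coeff_single, HahnSeries.coeff_smul]
  split_ifs <;> simp

/-- Expresses a row of $\overline\sigma_-$ entries through the rows of $h$ entries above and
including it. As the combining polynomial has degree at most $k\le l$, no row of negative index is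
needed. -/
theorem sigmaForm_eq_sum {r l : ℕ} (hr : 0 < r) (hl : k ≤ l) (v : V) :
    sigmaForm r k l v =
      ∑ p ∈ range (l + 1), invZCoeff r k p * HahnSeries.C (hForm r (l - p) v) := by
  induction v using Finsupp.induction_linear with
  | zero => simp
  | add v w hv hw =>
    simp only [map_add, mul_add, Finset.sum_add_distrib, hv, hw]
  | single n c =>
    have h1 : (Finsupp.single n c : V) = c • b n := by simp [b]
    rw [h1, map_smul, sigmaForm_b, sigmaBarH_eq_sum hr _ hl, Finset.smul_sum]
    refine Finset.sum_congr rfl fun p hp => ?_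
    rw [map_smul, hForm_b, C_smul_rat, mul_smul_comm]
    rw [Finset.mem_range] at hp
    congr 4
    omega

/-- The lower unitriangular matrix of the row operations. -/
def rowOp (r k : ℕ) : Matrix (Fin r) (Fin r) (Laurent r k) :=
  Matrix.of fun i l => if i.val < k then (if l = i then 1 else 0)
    else if l.val ≤ i.val then invZCoeff r k (i - l) else 0

theorem det_rowOp (r k : ℕ) : (rowOp r k).det = 1 := by
  rw [Matrix.det_of_isLowerTriangular]
  · refine Finset.prod_eq_one fun i _ => ?_
    rw [rowOp, Matrix.of_apply]
    simp [invZCoeff_zero]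
  · intro i j hij
    rw [OrderDual.toDual_lt_toDual] at hij
    rw [rowOp, Matrix.of_apply, if_neg hij.ne', if_neg (not_le.2 (Fin.lt_def.1 hij)), ite_self]

theorem sum_rowOp_of_lt {r : ℕ} {i : Fin r} (hi : i.val < k) (F : ℕ → Laurent r k) :
    ∑ l : Fin r, rowOp r k i l * F l = F i := by
  simp [rowOp, hi]

theorem sum_rowOp_of_le {r : ℕ} {i : Fin r} (hi : k ≤ i.val) (F : ℕ → Laurent r k) :
    ∑ l : Fin r, rowOp r k i l * F l = ∑ p ∈ range (i + 1), invZCoeff r k p * F (i - p) := by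
  have h1 : ∀ l : Fin r, rowOp r k i l * F l =
      (fun l : ℕ => if l ≤ i.val then invZCoeff r k (i - l) * F l else 0) l := by
    intro l
    rw [rowOp, Matrix.of_apply, if_neg (by omega)]
    dsimp only
    split_ifs
    · rfl
    · rw [zero_mul]
  rw [Finset.sum_congr rfl fun l _ => h1 l, Fin.sum_univ_eq_sum_range
    (fun l : ℕ => if l ≤ i.val then invZCoeff r k (i - l) * F l else 0),
    ← Finset.sum_range_reflect _ (i.val + 1)]
  rw [← Finset.sum_subset (Finset.range_subset_range.2 i.2)]
  · refine Finset.sum_congr rfl fun l hl => ?_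
    rw [Finset.mem_range] at hl
    rw [if_pos (by omega)]
    congr 2
    omega
  · intro l _ hl
    rw [Finset.mem_range] at hl
    rw [if_neg (by omega)]

/-- The matrix `(z_j ^ {r - 1 - l})`. -/
def zMatrix (r k : ℕ) : Matrix (Fin k) (Fin k) (Laurent r k) :=
  Matrix.of fun l j => zpw r j ((r : ℤ) - 1 - l)

/-- The unitriangular row operation leaves the first $k$ rows alone. Below them, the left entries
become $z_j^{r-1-i}$ times the vanishing sum $\prod_i(1-z_i^{-1}t)|_{t=z_j}$, and the right entries
become the $\overline\sigma_-$ forms. The upper right block plays no role. -/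
theorem det_append_eq (m : ℕ) (v : Fin m → V) :
    (Matrix.of fun i : Fin (k + m) => Fin.append
        (fun j : Fin k => zpw (k + m) j (((k + m : ℕ) : ℤ) - 1 - i))
        (fun j : Fin m => (HahnSeries.C (hForm (k + m) i (v j)) : Laurent (k + m) k))).det =
      (zMatrix (k + m) k).det *
        wedgeForm (fun i : Fin m => sigmaForm (k + m) k (k + i)) (ExteriorAlgebra.ιMulti ℚ m v) := by
  set N := Matrix.of fun i : Fin (k + m) => Fin.append
        (fun j : Fin k => zpw (k + m) j (((k + m : ℕ) : ℤ) - 1 - i))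
        (fun j : Fin m => (HahnSeries.C (hForm (k + m) i (v j)) : Laurent (k + m) k)) with hN
  have hl : ∀ i j, (rowOp (k + m) k * N) i (Fin.castAdd m j) =
      ∑ l : Fin (k + m), rowOp (k + m) k i l *
        (fun l : ℕ => zpw (k + m) j (((k + m : ℕ) : ℤ) - 1 - l)) l := by
    intro i j
    simp [Matrix.mul_apply, hN]
  have hr : ∀ i j, (rowOp (k + m) k * N) i (Fin.natAdd k j) =
      ∑ l : Fin (k + m), rowOp (k + m) k i l *
        (fun l : ℕ => HahnSeries.C (hForm (k + m) l (v j))) l := by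
    intro i j
    simp [Matrix.mul_apply, hN]
  have h11 : ∀ i j : Fin k, (rowOp (k + m) k * N) (Fin.castAdd m i) (Fin.castAdd m j) =
      zMatrix (k + m) k i j := by
    intro i j
    rw [hl]
    exact sum_rowOp_of_lt (i := Fin.castAdd m i) i.2
      fun l : ℕ => zpw (k + m) j (((k + m : ℕ) : ℤ) - 1 - l)
  have h21 : ∀ (i : Fin m) (j : Fin k),
      (rowOp (k + m) k * N) (Fin.natAdd k i) (Fin.castAdd m j) = 0 := by
    intro i j
    rw [hl]
    refine (sum_rowOp_of_le (i := Fin.natAdd k i) (Nat.le_add_right _ _)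
      fun l : ℕ => zpw (k + m) j (((k + m : ℕ) : ℤ) - 1 - l)).trans ?_
    have h1 := sum_invZCoeff_mul_zpw (r := k + m) j (N := k + i) (by omega)
    have h2 := congrArg (zpw (k + m) j (((k + m : ℕ) : ℤ) - 1 - ((k + i : ℕ) : ℤ)) * ·) h1
    simp only [mul_zero, Finset.mul_sum] at h2
    rw [← h2]
    refine Finset.sum_congr rfl fun p hp => ?_
    rw [Finset.mem_range] at hp
    rw [mul_left_comm, ← zpw_add, Fin.val_natAdd]
    congr 2
    omega
  have h22 : ∀ i j : Fin m, (rowOp (k + m) k * N) (Fin.natAdd k i) (Fin.natAdd k j) =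
      sigmaForm (k + m) k (k + i) (v j) := by
    intro i j
    have hi := i.2
    rw [hr, sigmaForm_eq_sum (by omega) (by omega)]
    exact sum_rowOp_of_le (i := Fin.natAdd k i) (Nat.le_add_right _ _)
      fun l : ℕ => HahnSeries.C (hForm (k + m) l (v j))
  rw [← one_mul N.det, ← det_rowOp (k + m) k, ← Matrix.det_mul,
    ← Matrix.det_submatrix_equiv_self finSumFinEquiv]
  have hB : (rowOp (k + m) k * N).submatrix finSumFinEquiv finSumFinEquiv = Matrix.fromBlocks
      (zMatrix (k + m) k)
      (Matrix.of fun i j => (rowOp (k + m) k * N) (Fin.castAdd m i) (Fin.natAdd k j)) 0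
      (Matrix.of fun i j : Fin m => sigmaForm (k + m) k (k + i) (v j)) := by
    ext1 i j
    rcases i with i | i <;> rcases j with j | j
    · exact h11 i j
    · rfl
    · exact h21 i j
    · exact h22 i j
  rw [hB, Matrix.det_fromBlocks_zero₂₁, wedgeForm_ιMulti]

/-! ### Closed form of the generating function -/

theorem toLaurent_hSeries_subst {r l : ℕ} (hl : l < r) (j : Fin k) :
    toLaurent r k ((hSeries r l).subst
        (MvPowerSeries.X (Sum.inl j) : MvPowerSeries (Fin k ⊕ Fin k) (B r))) =
      toLaurent r k ((invE r).subst
        (MvPowerSeries.X (Sum.inl j) : MvPowerSeries (Fin k ⊕ Fin k) (B r))) *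
        zpw r j ((r : ℤ) - 1 - l) := by
  have hX : PowerSeries.HasSubst
    (MvPowerSeries.X (Sum.inl j) : MvPowerSeries (Fin k ⊕ Fin k) (B r)) := PowerSeries.HasSubst.X _
  rw [hSeries_eq hl, PowerSeries.subst_mul hX, PowerSeries.subst_pow hX, PowerSeries.subst_X hX,
    map_mul, map_pow, toLaurent_X_inl, zpw_pow, mul_comm]
  congr 2
  omega

theorem toLaurent_wedgeSeries_ιMulti (m : ℕ) (v : Fin m → V) :
    toLaurent (k + m) k (wedgeSeries (k + m) k (ExteriorAlgebra.ιMulti ℚ m v)) =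
      toLaurent (k + m) k (prodInvE (k + m) k) * ((zMatrix (k + m) k).det *
        wedgeForm (fun i : Fin m => sigmaForm (k + m) k (k + i))
          (ExteriorAlgebra.ιMulti ℚ m v)) := by
  rw [wedgeSeries_ιMulti, RingHom.map_det, ← det_append_eq]
  have h1 : (toLaurent (k + m) k) (prodInvE (k + m) k) = ∏ j : Fin (k + m), Fin.append
      (fun j : Fin k => toLaurent (k + m) k ((invE (k + m)).subst
        (MvPowerSeries.X (Sum.inl j) : MvPowerSeries (Fin k ⊕ Fin k) (B (k + m)))))
      (fun _ : Fin m => 1) j := by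
    rw [Fin.prod_univ_add, prodInvE, map_prod]
    simp
  rw [h1, ← Matrix.det_mul_row]
  congr 1
  ext1 i j
  rw [RingHom.mapMatrix_apply, Matrix.map_apply, Matrix.of_apply, Matrix.of_apply]
  refine Fin.addCases (fun j => ?_) (fun j => ?_) j
  · simp only [Fin.append_left, Matrix.of_apply]
    exact toLaurent_hSeries_subst i.2 j
  · simp only [Fin.append_right, Matrix.of_apply, one_mul]
    exact toLaurent_C _

/-- Both sides are $\mathbb Q$-linear in $u$ and vanish on wedges of degree other than $m$. -/
theorem toLaurent_wedgeSeries (m : ℕ) (u : Wedge) :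
    toLaurent (k + m) k (wedgeSeries (k + m) k u) =
      toLaurent (k + m) k (prodInvE (k + m) k) * ((zMatrix (k + m) k).det *
        wedgeForm (fun i : Fin m => sigmaForm (k + m) k (k + i)) u) := by
  suffices h : (toLaurent (k + m) k).toRatAlgHom.toLinearMap.comp (wedgeSeries (k + m) k) =
      (LinearMap.mulLeft ℚ (toLaurent (k + m) k (prodInvE (k + m) k))).comp
        ((LinearMap.mulLeft ℚ (zMatrix (k + m) k).det).comp
          (wedgeForm (fun i : Fin m => sigmaForm (k + m) k (k + i)))) from LinearMap.congr_fun h u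
  apply ExteriorAlgebra.lhom_ext
  intro n
  ext1 v
  change toLaurent (k + m) k (wedgeSeries (k + m) k (ExteriorAlgebra.ιMulti ℚ n v)) =
    toLaurent (k + m) k (prodInvE (k + m) k) * ((zMatrix (k + m) k).det *
      wedgeForm (fun i : Fin m => sigmaForm (k + m) k (k + i)) (ExteriorAlgebra.ιMulti ℚ n v))
  rcases eq_or_ne n m with rfl | hn
  · exact toLaurent_wedgeSeries_ιMulti n v
  · rw [wedgeForm_ιMulti_of_ne hn, mul_zero, mul_zero]
    have h1 : wedgeSeries (k + m) k (ExteriorAlgebra.ιMulti ℚ n v) = 0 := by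
      ext1 x
      rw [coeff_wedgeSeries, ExteriorAlgebra.ιMulti_mul_ιMulti, toB_ιMulti_of_ne (by omega),
        ite_self, map_zero]
    rw [h1, map_zero]

end

section

/-! ### Vandermonde factors in the Laurent ring -/

variable {k m : ℕ}

theorem det_pow_rev {R : Type*} [CommRing R] (x : Fin k → R) :
    (Matrix.of fun i j : Fin k => x j ^ (k - 1 - i.val)).det =
      ∏ i : Fin k, ∏ j ∈ Ioi i, (x i - x j) := by
  have h1 := Matrix.det_projVandermonde (fun _ => (1 : R)) x
  simp only [one_mul] at h1
  rw [← h1, ← Matrix.det_transpose]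
  congr 1
  ext1 i j
  simp only [Matrix.transpose_apply, Matrix.of_apply, Matrix.projVandermonde_apply, one_pow,
    one_mul, Fin.val_rev]
  congr 1
  omega

theorem toLaurent_polySeries_rename_decVandermonde (r : ℕ) (e : Fin k → Fin k ⊕ Fin k) :
    toLaurent r k (polySeries r k (MvPolynomial.rename e (decVandermonde k))) =
      ∏ i : Fin k, ∏ j ∈ Ioi i, (toLaurent r k (MvPowerSeries.X (e i)) -
        toLaurent r k (MvPowerSeries.X (e j))) := by
  rw [← det_pow_rev, decVandermonde, powDet]
  have h1 : ∀ s, polySeries r k (MvPolynomial.X s) = MvPowerSeries.X s := by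
    intro s
    simp [polySeries]
  rw [AlgHom.map_det, RingHom.map_det, RingHom.map_det]
  congr 1
  ext1 i j
  simp [h1]

/-- Each factor is a unit times a nonzerodivisor: $z_i-z_j=z_i(1-z_j/z_i)$. -/
theorem toLaurent_polySeries_vandermonde_z_mem (r : ℕ) :
    toLaurent r k (polySeries r k (MvPolynomial.rename Sum.inl (decVandermonde k))) ∈
      nonZeroDivisors (Laurent r k) := by
  rw [toLaurent_polySeries_rename_decVandermonde]
  refine Submonoid.prod_mem _ fun i _ => Submonoid.prod_mem _ fun j hj => ?_
  have h1 : toLaurent r k (MvPowerSeries.X (Sum.inl i)) -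
      toLaurent r k (MvPowerSeries.X (Sum.inl j)) =
      zpw r i 1 * (1 - zpw r j 1 * zpw r i (-1)) := by
    have h2 : zpw r i 1 * zpw r i (-1) = 1 := by rw [← zpw_add, add_neg_cancel, zpw_zero]
    rw [toLaurent_X_inl, toLaurent_X_inl]
    linear_combination (zpw r j 1) * h2
  rw [h1]
  exact Submonoid.mul_mem _ (isUnit_zpw _ _).mem_nonZeroDivisors
    (one_sub_zpw_mem_nonZeroDivisors (Finset.mem_Ioi.1 hj).ne')

/-- Each factor is $w_i^{-1}-w_j^{-1}=w_i^{-1}(1-w_i/w_j)$, and $i$ is the smaller index in $k-1-i$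
of the pairs. -/
theorem toLaurent_polySeries_vandermonde_w (r : ℕ) :
    toLaurent r k (polySeries r k (MvPolynomial.rename Sum.inr (decVandermonde k))) =
      (∏ i : Fin k, wpw r i (-((k : ℤ) - 1 - i))) *
        ∏ i : Fin k, ∏ j ∈ Ioi i, (1 - wpw r i 1 * wpw r j (-1)) := by
  rw [toLaurent_polySeries_rename_decVandermonde, ← Finset.prod_mul_distrib]
  refine Finset.prod_congr rfl fun i _ => ?_
  have h1 : wpw r i (-((k : ℤ) - 1 - i)) = ∏ _j ∈ Ioi i, wpw r i (-1) := by
    rw [Finset.prod_const, Fin.card_Ioi, wpw_pow]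
    congr 1
    have := i.2
    omega
  rw [h1, ← Finset.prod_mul_distrib]
  refine Finset.prod_congr rfl fun j _ => ?_
  have h2 : wpw r i (-1) * wpw r i 1 = 1 := by rw [← wpw_add, neg_add_cancel, wpw_zero]
  rw [toLaurent_X_inr, toLaurent_X_inr]
  linear_combination (wpw r j (-1)) * h2

theorem det_zMatrix (r : ℕ) :
    (zMatrix r k).det = (∏ j : Fin k, zpw r j ((r : ℤ) - k)) *
      toLaurent r k (polySeries r k (MvPolynomial.rename Sum.inl (decVandermonde k))) := by
  rw [toLaurent_polySeries_rename_decVandermonde, ← det_pow_rev, ← Matrix.det_mul_row]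
  congr 1
  ext1 l j
  rw [zMatrix, Matrix.of_apply, Matrix.of_apply, Matrix.of_apply, toLaurent_X_inl, zpw_pow,
    ← zpw_add]
  congr 1
  have := l.2
  omega

/-! ### Summation over the contractions -/

/-- Multilinearity in the top $k$ rows: weighting the indicator row of $c_i$ by $t_i(c_i)$ and
summing over $c_i$ evaluates $t_i$ at every $a_j$. The bound $N$ makes the range reach all of them.
-/
theorem sum_mul_det_append {R : Type*} [CommRing R] {N : ℕ} (a : Fin (k + m) → ℕ)
    (ha : ∀ j, a j < N) (t : Fin k → ℕ → R) (ρ : Fin m → Fin (k + m) → R) :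
    ∑ c ∈ Fintype.piFinset fun _ : Fin k => range N, (∏ i, t i (c i)) *
        (Matrix.of (Fin.append (fun i j => if a j = c i then 1 else 0) ρ)).det =
      (Matrix.of (Fin.append (fun i j => t i (a j)) ρ)).det := by
  have h1 : ∀ q : Fin k → Fin (k + m) → R, (Matrix.of (Fin.append q ρ)).det =
      ∑ σ : Equiv.Perm (Fin (k + m)), ((Equiv.Perm.sign σ : ℤ) : R) *
        ((∏ i, q i (σ (Fin.castAdd m i))) * ∏ i, ρ i (σ (Fin.natAdd k i))) := by
    intro q
    rw [← Matrix.det_transpose, Matrix.det_apply']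
    refine Finset.sum_congr rfl fun σ _ => ?_
    rw [Fin.prod_univ_add]
    simp
  simp_rw [h1, Finset.mul_sum]
  rw [Finset.sum_comm]
  refine Finset.sum_congr rfl fun σ _ => ?_
  have h2 : ∏ i, t i (a (σ (Fin.castAdd m i))) =
      ∑ c ∈ Fintype.piFinset fun _ : Fin k => range N,
        ∏ i, t i (c i) * (if a (σ (Fin.castAdd m i)) = c i then 1 else 0) := by
    rw [← Finset.prod_univ_sum (fun _ : Fin k => range N)
      fun i n => t i n * (if a (σ (Fin.castAdd m i)) = n then 1 else 0)]
    refine Finset.prod_congr rfl fun i _ => ?_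
    simp [ha]
  rw [h2, Finset.sum_mul, Finset.mul_sum]
  refine Finset.sum_congr rfl fun c _ => ?_
  rw [Finset.prod_mul_distrib]
  ring

/-- The contraction `β_{c_1} ∧ ⋯ ∧ β_{c_k} ⌟ (b_{a_1} ∧ ⋯ ∧ b_{a_r})`. -/
def contracted (a : Fin (k + m) → ℕ) (c : Fin k → ℕ) : Wedge :=
  contractMulti (fun i => beta (c i)) (ExteriorAlgebra.ιMulti ℚ (k + m) fun j => b (a j))

theorem toLaurent_wedgeSeries_contracted (a : Fin (k + m) → ℕ) (c : Fin k → ℕ) :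
    toLaurent (k + m) k (wedgeSeries (k + m) k (contracted a c)) =
      toLaurent (k + m) k (prodInvE (k + m) k) * ((zMatrix (k + m) k).det *
        (Matrix.of (Fin.append (fun i j => if a j = c i then 1 else 0)
          fun (i : Fin m) j => sigmaForm (k + m) k (k + i) (b (a j)))).det) := by
  rw [toLaurent_wedgeSeries, contracted, wedgeForm_contractMulti _ _ rfl
    (Fin.append (fun i => (Algebra.linearMap ℚ (Laurent (k + m) k)).comp (beta (c i)))
      fun i : Fin m => sigmaForm (k + m) k (k + i)), wedgeForm_ιMulti]
  · congr 3
    ext1 i j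
    rw [Matrix.of_apply, Matrix.of_apply]
    refine Fin.addCases (fun i => ?_) (fun i => ?_) i
    · rw [Fin.append_left, Fin.append_left, LinearMap.comp_apply, beta, b, Finsupp.lapply_apply,
        Finsupp.single_apply]
      split_ifs <;> simp
    · rw [Fin.append_right, Fin.append_right]
  · intro i v
    exact LinearMap.congr_fun (Fin.append_left _ _ i) v
  · intro i
    exact Fin.append_right _ _ i

/-- The indicator row of $c_i$ is zero. This and the next two facts are read off the determinant and
pulled back along the injective `toLaurent`. -/
theorem wedgeSeries_contracted_eq_zero {a : Fin (k + m) → ℕ} {c : Fin k → ℕ} {i : Fin k}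
    (hi : ∀ j, a j ≠ c i) : wedgeSeries (k + m) k (contracted a c) = 0 := by
  apply toLaurent_injective
  rw [toLaurent_wedgeSeries_contracted, Matrix.det_eq_zero_of_row_eq_zero (Fin.castAdd m i),
    mul_zero, mul_zero, map_zero]
  intro j
  rw [Matrix.of_apply, Fin.append_left, if_neg (hi j)]

theorem wedgeSeries_contracted_of_not_injective (a : Fin (k + m) → ℕ) {c : Fin k → ℕ}
    (hc : ¬ Function.Injective c) : wedgeSeries (k + m) k (contracted a c) = 0 := by
  apply toLaurent_injective
  obtain ⟨i, j, hij, hne⟩ := Function.not_injective_iff.1 hc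
  rw [toLaurent_wedgeSeries_contracted, Matrix.det_zero_of_row_eq (i := Fin.castAdd m i)
    (j := Fin.castAdd m j), mul_zero, mul_zero, map_zero]
  · simpa using hne
  · funext l
    rw [Matrix.of_apply, Matrix.of_apply, Fin.append_left, Fin.append_left, hij]

theorem wedgeSeries_contracted_comp_perm (a : Fin (k + m) → ℕ) (c : Fin k → ℕ)
    (σ : Equiv.Perm (Fin k)) : wedgeSeries (k + m) k (contracted a (c ∘ σ)) =
      ((Equiv.Perm.sign σ : ℤ) : MvPowerSeries (Fin k ⊕ Fin k) (B (k + m))) *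
        wedgeSeries (k + m) k (contracted a c) := by
  apply toLaurent_injective
  have h1 := Matrix.det_permute
    -- Extending $\sigma$ by the identity on the lower $m$ rows preserves its sign.
    (finSumFinEquiv.permCongr (Equiv.Perm.sumCongr σ (1 : Equiv.Perm (Fin m))))
    (Matrix.of (Fin.append (fun i j => if a j = c i then 1 else 0)
      fun (i : Fin m) j => sigmaForm (k + m) k (k + i) (b (a j))))
  rw [Equiv.Perm.sign_permCongr, Equiv.Perm.sign_sumCongr, Equiv.Perm.sign_one, mul_one] at h1
  have h2 : Matrix.of (Fin.append (fun i j => if a j = (c ∘ σ) i then 1 else 0)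
      fun (i : Fin m) j => sigmaForm (k + m) k (k + i) (b (a j))) =
      (Matrix.of (Fin.append (fun i j => if a j = c i then 1 else 0)
        fun (i : Fin m) j => sigmaForm (k + m) k (k + i) (b (a j)))).submatrix
        (finSumFinEquiv.permCongr (Equiv.Perm.sumCongr σ (1 : Equiv.Perm (Fin m)))) id := by
    ext1 i j
    refine Fin.addCases (fun i => ?_) (fun i => ?_) i <;> simp
  rw [map_mul, map_intCast, toLaurent_wedgeSeries_contracted, toLaurent_wedgeSeries_contracted,
    h2, h1]
  ring

/-! ### The main identity -/

/-- The element `b_{e_1} ∧ ⋯ ∧ b_{e_k} ∧ (β_{c_1} ∧ ⋯ ∧ β_{c_k} ⌟ (b_{a_1} ∧ ⋯ ∧ b_{a_r}))` of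
`⋀^r V`, transported to `B_r`. -/
def matrixCoeff (a : Fin (k + m) → ℕ) (e c : Fin k → ℕ) : B (k + m) :=
  toB (k + m) ((ExteriorAlgebra.ιMulti ℚ k fun j => b (e j)) * contracted a c)

theorem matrixCoeff_eq_coeff (a : Fin (k + m) → ℕ) (e c : Fin k → ℕ) :
    matrixCoeff a e c = MvPowerSeries.coeff (Finsupp.equivFunOnFinite.symm (Sum.elim e 0))
      (wedgeSeries (k + m) k (contracted a c)) := by
  rw [coeff_wedgeSeries, if_pos]
  · rfl
  · ext j
    simp [wPart]

theorem elemOp_schurDet (lam : Part (k + m)) (mu nu : Part k) :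
    elemOp (k + m) mu nu (schurDet lam) = matrixCoeff (decExp lam) (decExp mu) (decExp nu) := by
  change toB (k + m) (wedgeB mu * contraction nu (fermion (k + m) (schurDet lam) : Wedge)) = _
  rw [fermion_schurDet]
  rfl

theorem coeff_vandermondePair_mul_genOp_schurDet (lam : Part (k + m)) (x : Fin k ⊕ Fin k →₀ ℕ) :
    MvPowerSeries.coeff x (polySeries (k + m) k (vandermondePair k) *
      genOp (k + m) k (schurDet lam)) = matrixCoeff (decExp lam) (zPart x) (wPart x) := by
  refine coeff_vandermondePair_mul_genOp _ _ _ (elemOp_schurDet lam) ?_ ?_ ?_ ?_ x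
  · intro e c σ
    have h1 := (ExteriorAlgebra.ιMulti ℚ k).map_perm (fun j => b (e j)) σ
    change toB (k + m) (ExteriorAlgebra.ιMulti ℚ k ((fun j => b (e j)) ∘ σ) * _) = _
    rw [h1, matrixCoeff]
    rcases Int.units_eq_one_or (Equiv.Perm.sign σ) with h2 | h2 <;> simp [h2]
  · intro e c σ
    rw [matrixCoeff_eq_coeff, matrixCoeff_eq_coeff, wedgeSeries_contracted_comp_perm]
    rcases Int.units_eq_one_or (Equiv.Perm.sign σ) with h2 | h2 <;> simp [h2]
  · intro e c he
    rw [matrixCoeff, ExteriorAlgebra.ιMulti_eq_zero_of_not_inj, zero_mul, map_zero]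
    intro h1
    exact he fun i j hij => h1 (congrArg b hij)
  · intro e c hc
    rw [matrixCoeff_eq_coeff, wedgeSeries_contracted_of_not_injective _ hc, map_zero]

/-- The series is polynomial in the $w_i^{-1}$: if some $c_i\ge N$, then $\beta_{c_i}$ kills every
factor of $[\mathbf b]^r_\lambda$. So the sum over $c$ can be taken finite and exchanged with the
embedding. -/
theorem vandermondePair_mul_genOp_schurDet (lam : Part (k + m)) {N : ℕ}
    (hN : ∀ j, decExp lam j < N) :
    polySeries (k + m) k (vandermondePair k) * genOp (k + m) k (schurDet lam) =
      ∑ c ∈ Fintype.piFinset fun _ : Fin k => range N,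
        MvPowerSeries.monomial (Finsupp.equivFunOnFinite.symm (Sum.elim 0 c)) 1 *
          wedgeSeries (k + m) k (contracted (decExp lam) c) := by
  classical
  ext1 x
  rw [coeff_vandermondePair_mul_genOp_schurDet, map_sum]
  have h1 : ∀ c : Fin k → ℕ, MvPowerSeries.coeff x
      (MvPowerSeries.monomial (Finsupp.equivFunOnFinite.symm (Sum.elim 0 c)) 1 *
        wedgeSeries (k + m) k (contracted (decExp lam) c)) =
      if c = wPart x then matrixCoeff (decExp lam) (zPart x) c else 0 := by
    intro c
    rw [MvPowerSeries.coeff_monomial_mul, one_mul, coeff_wedgeSeries, ← ite_and]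
    have hz : zPart (x - Finsupp.equivFunOnFinite.symm (Sum.elim 0 c)) = zPart x := by
      ext j
      simp [zPart]
    have hiff : (Finsupp.equivFunOnFinite.symm (Sum.elim 0 c) ≤ x ∧
        wPart (x - Finsupp.equivFunOnFinite.symm (Sum.elim 0 c)) = 0) ↔ c = wPart x := by
      constructor
      · rintro ⟨h2, h3⟩
        funext j
        have h4 := h2 (Sum.inr j)
        have h5 := DFunLike.congr_fun h3 j
        simp [wPart] at h4 h5 ⊢
        omega
      · rintro rfl
        constructor
        · rintro (j | j) <;> simp [wPart]
        · ext j
          simp [wPart]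
    rw [if_congr hiff rfl rfl, hz]
    rfl
  rw [Finset.sum_congr rfl fun c _ => h1 c, Finset.sum_ite_eq']
  split_ifs with hc
  · rfl
  · obtain ⟨i, hi⟩ : ∃ i, N ≤ wPart x i := by
      by_contra! h2
      exact hc (Fintype.mem_piFinset.2 fun i => Finset.mem_range.2 (h2 i))
    rw [matrixCoeff_eq_coeff, wedgeSeries_contracted_eq_zero (i := i), map_zero]
    intro j
    have := hN j
    omega

theorem toLaurent_monomial_wPart (r : ℕ) (c : Fin k → ℕ) :
    toLaurent r k (MvPowerSeries.monomial (Finsupp.equivFunOnFinite.symm (Sum.elim 0 c)) 1) =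
      ∏ i, wpw r i (-(c i : ℤ)) := by
  rw [MvPowerSeries.monomial_eq', map_one, one_mul, Finsupp.prod_fintype _ _ (by simp),
    Fintype.prod_sum_type, map_mul, map_prod, map_prod]
  simp [toLaurent_X_inr, wpw_pow]

theorem toLaurent_vandermondePair_mul_genOp (lam : Part (k + m)) :
    toLaurent (k + m) k (polySeries (k + m) k (vandermondePair k)) *
        toLaurent (k + m) k (genOp (k + m) k (schurDet lam)) =
      toLaurent (k + m) k (prodInvE (k + m) k) * ((zMatrix (k + m) k).det *
        (Matrix.of (Fin.append (fun i j => wpw (k + m) i (-(decExp lam j : ℤ)))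
          fun (i : Fin m) j => sigmaForm (k + m) k (k + i) (b (decExp lam j)))).det) := by
  have hN : ∀ j, decExp lam j < (∑ j, decExp lam j) + 1 := fun j =>
    Nat.lt_succ_of_le (Finset.single_le_sum (fun _ _ => Nat.zero_le _) (mem_univ j))
  rw [← map_mul, vandermondePair_mul_genOp_schurDet lam hN, map_sum,
    ← sum_mul_det_append _ hN fun i n => wpw (k + m) i (-(n : ℤ)), Finset.mul_sum, Finset.mul_sum]
  refine Finset.sum_congr rfl fun c _ => ?_
  rw [map_mul, toLaurent_monomial_wPart, toLaurent_wedgeSeries_contracted]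
  ring

/-- With indices from 0, $-(\lambda_j-j+i)=(r-1-i)-(r-1-j+\lambda_j)$, so each $w$ row differs by
the factor $w_i^{r-1-i}$. -/
theorem mixedDet_eq (lam : Part (k + m)) :
    mixedDet k lam = (∏ i : Fin k, wpw (k + m) i (((k + m : ℕ) : ℤ) - 1 - i)) *
      (Matrix.of (Fin.append (fun i j => wpw (k + m) i (-(decExp lam j : ℤ)))
        fun (i : Fin m) j => sigmaForm (k + m) k (k + i) (b (decExp lam j)))).det := by
  have h1 : ∏ i : Fin k, wpw (k + m) i (((k + m : ℕ) : ℤ) - 1 - i) =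
      ∏ i : Fin (k + m), Fin.append (fun i : Fin k => wpw (k + m) i (((k + m : ℕ) : ℤ) - 1 - i))
        (fun _ : Fin m => 1) i := by
    rw [Fin.prod_univ_add]
    simp
  rw [h1, ← Matrix.det_mul_column, mixedDet]
  congr 1
  ext1 i j
  have hj := j.2
  rw [Matrix.of_apply, Matrix.of_apply, Matrix.of_apply]
  refine Fin.addCases (fun i => ?_) (fun i => ?_) i
  · rw [Fin.append_left, Fin.append_left, dif_pos (show (Fin.castAdd m i).val < k from i.2),
      ← wpw_add]
    simp only [decExp, Fin.val_castAdd]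
    congr 1
    omega
  · rw [Fin.append_right, Fin.append_right, one_mul, dif_neg (by simp), sigmaForm_b]
    simp only [decExp, Fin.val_natAdd]
    congr 1
    omega

theorem prod_mul_toLaurent_genOp (lam : Part (k + m)) :
    (∏ i : Fin k, ∏ j ∈ Finset.Ioi i, (1 - wpw (k + m) i 1 * wpw (k + m) j (-1))) *
        toLaurent (k + m) k (genOp (k + m) k (schurDet lam)) =
      (∏ j : Fin k, (zpw (k + m) j (((k + m : ℕ) : ℤ) - k) *
        wpw (k + m) j (-(((k + m : ℕ) : ℤ) - k)))) *
          toLaurent (k + m) k (prodInvE (k + m) k) * mixedDet k lam := by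
  have h1 := toLaurent_vandermondePair_mul_genOp lam
  rw [vandermondePair, map_mul, map_mul, det_zMatrix] at h1
  have hz := toLaurent_polySeries_vandermonde_z_mem (k := k) (k + m)
  have h2 := toLaurent_polySeries_vandermonde_w (k := k) (k + m)
  have hw1 : (∏ i : Fin k, wpw (k + m) i ((k : ℤ) - 1 - i)) *
      (∏ i : Fin k, wpw (k + m) i (-((k : ℤ) - 1 - i))) = 1 := by
    rw [← Finset.prod_mul_distrib]
    exact Finset.prod_eq_one fun i _ => by rw [← wpw_add, add_neg_cancel, wpw_zero]
  -- The powers of $w_i$ balance: $-(r-k)+(r-1-i)=k-1-i$, the exponent coming from $V(w^{-1})$.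
  have hw2 : (∏ i : Fin k, wpw (k + m) i (-(((k + m : ℕ) : ℤ) - k))) *
      (∏ i : Fin k, wpw (k + m) i (((k + m : ℕ) : ℤ) - 1 - i)) =
      ∏ i : Fin k, wpw (k + m) i ((k : ℤ) - 1 - i) := by
    rw [← Finset.prod_mul_distrib]
    refine Finset.prod_congr rfl fun i _ => ?_
    rw [← wpw_add]
    congr 1
    ring
  rw [mixedDet_eq, Finset.prod_mul_distrib]
  rw [h2] at h1
  generalize toLaurent (k + m) k (polySeries (k + m) k
    (MvPolynomial.rename Sum.inl (decVandermonde k))) = Vz at *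
  generalize (∏ i : Fin k, wpw (k + m) i ((k : ℤ) - 1 - i)) = W₁ at *
  generalize (∏ i : Fin k, wpw (k + m) i (-((k : ℤ) - 1 - i))) = W₂ at *
  generalize (∏ i : Fin k, wpw (k + m) i (-(((k + m : ℕ) : ℤ) - k))) = W₃ at *
  generalize (∏ i : Fin k, wpw (k + m) i (((k + m : ℕ) : ℤ) - 1 - i)) = W₄ at *
  generalize (Matrix.of (Fin.append (fun i j => wpw (k + m) i (-(decExp lam j : ℤ)))
    fun (i : Fin m) j => sigmaForm (k + m) k (k + i) (b (decExp lam j)))).det = D at *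
  generalize toLaurent (k + m) k (prodInvE (k + m) k) = P at *
  generalize toLaurent (k + m) k (genOp (k + m) k (schurDet lam)) = G at *
  generalize (∏ j : Fin k, zpw (k + m) j (((k + m : ℕ) : ℤ) - k)) = Z at *
  generalize (∏ i : Fin k, ∏ j ∈ Finset.Ioi i, (1 - wpw (k + m) i 1 * wpw (k + m) j (-1))) = A at *
  -- Both sides carry $V(z)$: on the left from clearing the Schur denominators, on the right from
  -- $\det(z_j^{r-1-l})$.
  rw [← mul_cancel_left_mem_nonZeroDivisors hz]
  linear_combination W₁ * h1 - Vz * A * G * hw1 - Vz * Z * P * D * hw2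

end

end SchubertVertex

end

open SchubertVertex

theorem mainTheorem8 (r k : ℕ) (hk : k ≤ r) (lam : Part r) :
    -- the variables `x_j` are well defined by `exp (∑_{j ≥ 1} x_j z^j) = 1 / E_r(z)`
    (∃! x : ℕ → B r, x 0 = 0 ∧ expSeries x = invE r) ∧
    -- the series defining `𝓔(z_k, w_k⁻¹) f` is a finite sum in each degree
    (∀ (f : B r) (a : Fin k ⊕ Fin k →₀ ℕ),
      {p : Part k × Part k |
        MvPolynomial.coeff a (schurPair p.1 p.2) • elemOp r p.1 p.2 f ≠ 0}.Finite) ∧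
    -- dividing by `∏_{i < j} (1 - w_i / w_j)` is legitimate
    ((∏ i : Fin k, ∏ j ∈ Finset.Ioi i, (1 - wpw r i 1 * wpw r j (-1))) ∈
      nonZeroDivisors (Laurent r k)) ∧
    ∀ x : ℕ → B r, expSeries x = invE r →
      -- `j x_j` is the `j`-th power sum of the roots in every algebra in which `E_r(z)` splits
      (∀ (A : Type*) [CommRing A] [Algebra (B r) A] (y : Fin r → A),
        PowerSeries.map (algebraMap (B r) A) (E r) =
            ∏ i : Fin r, (1 - PowerSeries.C (y i) * PowerSeries.X) →
          ∀ j : ℕ, 1 ≤ j → (j : A) * algebraMap (B r) A (x j) = ∑ i : Fin r, y i ^ j) ∧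
      prodInvE r k = expPowerSum k x ∧
      (∏ i : Fin k, ∏ j ∈ Finset.Ioi i, (1 - wpw r i 1 * wpw r j (-1))) *
          toLaurent r k (genOp r k (schurDet lam)) =
        (∏ j : Fin k, (zpw r j ((r : ℤ) - k) * wpw r j (-((r : ℤ) - k)))) *
          toLaurent r k (expPowerSum k x) * mixedDet k lam := by
  refine ⟨existsUnique_expSeries_eq_invE r, finite_schurPair_smul_elemOp r,
    prod_one_sub_wpw_mem_nonZeroDivisors r k, fun x hx =>
    ⟨fun A _ _ y hy j hj => natCast_mul_eq_powerSum hx y hy hj, prodInvE_eq_expPowerSum k hx, ?_⟩⟩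
  rw [← prodInvE_eq_expPowerSum k hx]
  -- With $r=k+m$ the rows split into the $k$ rows in $w$ and the $m$ rows in
  -- $\overline\sigma_-(\mathbf z_k)H_r$.
  obtain ⟨m, rfl⟩ := Nat.exists_eq_add_of_le hk
  exact prod_mul_toLaurent_genOp lam
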